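/- There exists a numerical constant $c_5>0$ such that the following holds. Let $\delta>0$, $c_0>2c_5$, $d\ge 1$, and let $\tilde G\subset\mathbb C^{d\times d}$ be a finite set of unitary matrices carrying a probability distribution $\mathcal D$ (for instance the uniform one) that is a unitary 2-design, i.e. $\int_{\mathcal D}V^{\otimes 2}\otimes(V^\dagger)^{\otimes 2}\,dV=\int_{\mathrm{Haar}}V^{\otimes 2}\otimes(V^\dagger)^{\otimes 2}\,dV$. Let $C_1,\dots,C_m$ ($m\ge1$) be drawn independently from $\mathcal D$. Let $\beta\ge 0$, $\nu=\beta/\delta$, and suppose that $$m\ \ge\ (8c_0\nu^2)^2\, d^2\ln d .$$ For $A\in\mathbb C^{d\times d}$ let $\mathrm{vec}(A)\in\mathbb C^{d^2}$ be the vector of its entries (row by row), and for a Hermitian matrix $\Gamma\in\mathbb C^{d^2\times d^2}$, with entries $\Gamma_{(a,i),(b,j)}$, let $\mathcal A(\Gamma)=\bigl[\mathrm{vec}(\sqrt d\,C_i)^\dagger\,\Gamma\,\mathrm{vec}(\sqrt d\,C_i)\bigr]_{i=1}^m\in\mathbb R^m$, $\mathrm{Tr}_1(\Gamma)_{i,j}=\sum_a\Gamma_{(a,i),(a,j)}$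 and $\mathrm{Tr}_2(\Gamma)_{a,b}=\sum_i\Gamma_{(a,i),(b,i)}$. Then with probability at least $1-\exp\bigl(-\tfrac1{128}m\nu^{-4}\bigr)$ over the choice of the $C_i$, the following holds simultaneously for all unitary $U\in\mathbb C^{d\times d}$ with $|\mathrm{Tr}(C^\dagger U)|^2\le\beta$ for all $C\in\tilde G$ (``$U$ is non-spiky''), all $\eta\ge 0$ and all $\varepsilon\in\mathbb R^m$ with $\|\varepsilon\|_2\le\eta$: with $y=\mathcal A(\mathrm{vec}(U)\mathrm{vec}(U)^\dagger)+\varepsilon$, every solution $\Gamma_{\mathrm{opt}}$ of the convex program $$\begin{aligned}\text{minimize }\ &\mathrm{Tr}(\Gamma)\ \text{ over Hermitian } \Gamma\in\mathbb C^{d^2\times d^2}\ \text{ subject to}\\ &\|\mathcal A(\Gamma)-y\|_2\le\eta,\quad \Gamma\succeq 0,\quad \mathrm{Tr}_1(\Gamma)=\mathrm{Tr}_2(\Gamma)=\tfrac{1}{d}\mathrm{Tr}(\Gamma)\,I,\\ &0\le\mathrm{vec}(C)^\dagger\,\Gamma\,\mathrm{vec}(C)\le\beta\quad\text{for all } C\in\tilde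 G\end{aligned}$$ satisfies $$\|\Gamma_{\mathrm{opt}}-\mathrm{vec}(U)\mathrm{vec}(U)^\dagger\|_F\ \le\ \max\Bigl\{\delta\,\|\mathrm{vec}(U)\mathrm{vec}(U)^\dagger\|_F,\ \tfrac{16\eta\nu^2}{\sqrt m}\Bigl(1+\tfrac{2c_5}{c_0-2c_5}\Bigr)\Bigr\}.$$ (Here $\|\mathrm{vec}(U)\mathrm{vec}(U)^\dagger\|_F=d$. For $\beta=0$ no unitary matrix is non-spiky and the claim is void.) -/

import Mathlib

open MeasureTheory
open scoped Matrix Kronecker ComplexOrder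

noncomputable section

namespace PhaseLift

/-- The unitary group of `d × d` complex matrices. -/
abbrev U (d : ℕ) := Matrix.unitaryGroup (Fin d) ℂ

/-! The unitary group is a compact group; it carries its Borel σ-algebra and its normalized
Haar measure. -/

instance instMeasurableSpaceU (d : ℕ) : MeasurableSpace (U d) := borel (U d)

instance instBorelSpaceU (d : ℕ) : BorelSpace (U d) := ⟨rfl⟩

theorem isCompact_unitary (d : ℕ) :
    IsCompact ((Matrix.unitaryGroup (Fin d) ℂ : Set (Matrix (Fin d) (Fin d) ℂ))) := by
  have hK : IsCompact (Set.univ.pi fun _ : Fin d => Set.univ.pi fun _ : Fin d =>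
      Metric.closedBall (0 : ℂ) 1) :=
    isCompact_univ_pi fun _ => isCompact_univ_pi fun _ => isCompact_closedBall 0 1
  refine hK.of_isClosed_subset ?_ ?_
  · have h : (Matrix.unitaryGroup (Fin d) ℂ : Set (Matrix (Fin d) (Fin d) ℂ)) =
        {A | A * star A = 1} := by
      ext A
      exact Matrix.mem_unitaryGroup_iff
    rw [h]
    exact isClosed_eq (by fun_prop) continuous_const
  · intro A hA i _ j _
    simpa using entry_norm_bound_of_unitary hA i j

instance instCompactSpaceU (d : ℕ) : CompactSpace (U d) :=
  isCompact_iff_compactSpace.mp (isCompact_unitary d)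

/-- The Haar probability measure on the unitary group. -/
def haar (d : ℕ) : Measure (U d) :=
  Measure.haarMeasure (⊤ : TopologicalSpace.PositiveCompacts (U d))

/-- The `t`-fold Kronecker power `A ⊗ A ⊗ ⋯ ⊗ A`. -/
def kronPow {d : ℕ} (t : ℕ) (A : Matrix (Fin d) (Fin d) ℂ) :
    Matrix (Fin t → Fin d) (Fin t → Fin d) ℂ :=
  Matrix.of fun i j => ∏ k, A (i k) (j k)

/-- A distribution `D` on the unitary group is a unitary `t`-design if
`∫ V^{⊗t} ⊗ (V†)^{⊗t} dD = ∫ V^{⊗t} ⊗ (V†)^{⊗t} dHaar` (an equality of matrices, stated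
entry by entry). -/
def IsUnitaryDesign {d : ℕ} (t : ℕ) (D : Measure (U d)) : Prop :=
  ∀ p q : (Fin t → Fin d) × (Fin t → Fin d),
    ∫ V : U d, (kronPow t (V : Matrix (Fin d) (Fin d) ℂ) ⊗ₖ
        kronPow t (V : Matrix (Fin d) (Fin d) ℂ)ᴴ) p q ∂D =
    ∫ V : U d, (kronPow t (V : Matrix (Fin d) (Fin d) ℂ) ⊗ₖ
        kronPow t (V : Matrix (Fin d) (Fin d) ℂ)ᴴ) p q ∂(haar d)

/-- Row-by-row flattening of a `d × d` matrix into a vector of length `d²`. -/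
def vec {d : ℕ} (A : Matrix (Fin d) (Fin d) ℂ) : Fin d × Fin d → ℂ :=
  fun p => A p.1 p.2

/-- The rank-one matrix `vec(A) vec(A)†`. -/
def lift {d : ℕ} (A : Matrix (Fin d) (Fin d) ℂ) :
    Matrix (Fin d × Fin d) (Fin d × Fin d) ℂ :=
  Matrix.vecMulVec (vec A) (star (vec A))

/-- The number `vec(A)† Γ vec(A)`, which is real when `Γ` is Hermitian. -/
def quadForm {d : ℕ} (Γ : Matrix (Fin d × Fin d) (Fin d × Fin d) ℂ)
    (A : Matrix (Fin d) (Fin d) ℂ) : ℝ :=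
  (star (vec A) ⬝ᵥ (Γ *ᵥ vec A)).re

/-- The measurement operator `𝒜(Γ) = [vec(√d C_i)† Γ vec(√d C_i)]_{i=1}^m`. -/
def measOp {d m : ℕ} (C : Fin m → U d)
    (Γ : Matrix (Fin d × Fin d) (Fin d × Fin d) ℂ) : EuclideanSpace ℝ (Fin m) :=
  WithLp.toLp 2 fun i =>
    quadForm Γ (((Real.sqrt d : ℝ) : ℂ) • (C i : Matrix (Fin d) (Fin d) ℂ))

/-- Partial trace over the first index. -/
def ptrace₁ {d : ℕ} (Γ : Matrix (Fin d × Fin d) (Fin d × Fin d) ℂ) :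
    Matrix (Fin d) (Fin d) ℂ :=
  Matrix.of fun i j => ∑ a, Γ (a, i) (a, j)

/-- Partial trace over the second index. -/
def ptrace₂ {d : ℕ} (Γ : Matrix (Fin d × Fin d) (Fin d × Fin d) ℂ) :
    Matrix (Fin d) (Fin d) ℂ :=
  Matrix.of fun a b => ∑ i, Γ (a, i) (b, i)

/-- The unitary matrix `V` is non-spiky with respect to `G`, with parameter `β`:
`|Tr(C† V)|² ≤ β` for all `C ∈ G`. -/
def IsNonSpiky {d : ℕ} (G : Finset (U d)) (β : ℝ) (V : U d) : Prop :=
  ∀ C ∈ G, ‖((C : Matrix (Fin d) (Fin d) ℂ)ᴴ * (V : Matrix (Fin d) (Fin d) ℂ)).trace‖ ^ 2 ≤ β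

/-- The constraints of the PhaseLift program with the added non-spikiness constraint. Positive
semidefiniteness includes that `Γ` is Hermitian. -/
structure IsFeasible {d m : ℕ} (G : Finset (U d)) (β : ℝ) (C : Fin m → U d)
    (y : EuclideanSpace ℝ (Fin m)) (η : ℝ)
    (Γ : Matrix (Fin d × Fin d) (Fin d × Fin d) ℂ) : Prop where
  data : ‖measOp C Γ - y‖ ≤ η
  posSemidef : Γ.PosSemidef
  ptrace₁_eq : ptrace₁ Γ = (Γ.trace / (d : ℂ)) • (1 : Matrix (Fin d) (Fin d) ℂ)
  ptrace₂_eq : ptrace₂ Γ = (Γ.trace / (d : ℂ)) • (1 : Matrix (Fin d) (Fin d) ℂ)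
  nonSpiky : ∀ B ∈ G, 0 ≤ quadForm Γ (B : Matrix (Fin d) (Fin d) ℂ) ∧
    quadForm Γ (B : Matrix (Fin d) (Fin d) ℂ) ≤ β

/-- `Γ` is a solution of the PhaseLift program with the added non-spikiness constraint: it is
feasible, and its trace (a real number) is minimal among feasible matrices. -/
def IsSolution {d m : ℕ} (G : Finset (U d)) (β : ℝ) (C : Fin m → U d)
    (y : EuclideanSpace ℝ (Fin m)) (η : ℝ)
    (Γ : Matrix (Fin d × Fin d) (Fin d × Fin d) ℂ) : Prop :=
  IsFeasible G β C y η Γ ∧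
    ∀ Γ' : Matrix (Fin d × Fin d) (Fin d × Fin d) ℂ, IsFeasible G β C y η Γ' →
      Γ.trace.re ≤ Γ'.trace.re

section

open scoped Matrix.Norms.Frobenius

/-- The Frobenius norm. -/
def frobNorm {d : ℕ} (A : Matrix (Fin d × Fin d) (Fin d × Fin d) ℂ) : ℝ := ‖A‖

end

end PhaseLift

end

/-! If a solution `Γ` is farther than `δ * d` from `lift V`, normalize the difference to a matrix
`Z` of Frobenius norm 1. Since `lift V` is feasible, minimality gives `Z` nonpositive trace. Since
`Γ` is positive semidefinite and `lift V` has rank one, `Z` has at most one negative eigenvalue, so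
its trace norm is at most 2. Both matrices satisfy the non-spikiness bounds, so every measurement of
`Z` has modulus at most `ν = β / δ`. These facts define `IsTestMatrix`. It suffices that with high
probability the squared measurements of all test matrices at once sum to at least `m / 6`: the
measurements of `Γ - lift V` have norm at most `2 * η`, which then bounds the distance.

In mean, each squared measurement of a test matrix is at least 1. This is the second-moment formula
for Haar measure, which a 2-design shares, evaluated on matrices with scalar partial traces
(`moment_haar`, `frobNorm_sq_le_sum_weight_mul`). The formula comes from the commutant of `W ⊗ W`.

The uniform version is an empirical process bound (`prodMean_exists_sum_sq_lt_le`): symmetrization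
and the contraction principle bound the mean of the largest deficit by the Rademacher complexity of
the test matrices, and McDiarmid's inequality bounds its fluctuation by means of the `ν` bound.

The complexity (`rademacher_le`) is controlled by duality: trace norm at most 2 against the operator
norm of a random sum of measurement matrices. That norm is estimated through traces of even powers
of order about `log d`, whose means satisfy a recursion obtained from exchangeable pairs
(`prodMean_trace_pow_succ_le`). As `𝒟` has finite support, all means are finite weighted sums until
the final comparison with the product measure. -/

namespace PhaseLift

/-! ### Averages over independent draws from a finite weighted set. -/

/-- The expectation of `f (C 0, …, C (m - 1))` for independent `C i` with weights `w`. -/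
noncomputable def prodMean {α : Type*} [Fintype α] (w : α → ℝ) {m : ℕ} (f : (Fin m → α) → ℝ) : ℝ :=
  ∑ C, (∏ i, w (C i)) * f C

/-- `w` is a probability weight. -/
structure IsWeight {α : Type*} [Fintype α] (w : α → ℝ) : Prop where
  nonneg : ∀ a, 0 ≤ w a
  sum_eq : ∑ a, w a = 1

section ProdMean

variable {α : Type*} [Fintype α] {w : α → ℝ} {m : ℕ}

theorem prodMean_add (f g : (Fin m → α) → ℝ) :
    prodMean w (fun C => f C + g C) = prodMean w f + prodMean w g := by
  simp [prodMean, mul_add, Finset.sum_add_distrib]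

theorem prodMean_sub (f g : (Fin m → α) → ℝ) :
    prodMean w (fun C => f C - g C) = prodMean w f - prodMean w g := by
  simp [prodMean, mul_sub, Finset.sum_sub_distrib]

theorem prodMean_const_mul (c : ℝ) (f : (Fin m → α) → ℝ) :
    prodMean w (fun C => c * f C) = c * prodMean w f := by
  simp only [prodMean, Finset.mul_sum]
  exact Finset.sum_congr rfl fun C _ => by ring

theorem prodMean_sum {κ : Type*} (s : Finset κ) (f : κ → (Fin m → α) → ℝ) :
    prodMean w (fun C => ∑ k ∈ s, f k C) = ∑ k ∈ s, prodMean w (f k) := by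
  simp only [prodMean, Finset.mul_sum]
  exact Finset.sum_comm

theorem prodMean_mono (hw : IsWeight w) {f g : (Fin m → α) → ℝ} (h : ∀ C, f C ≤ g C) :
    prodMean w f ≤ prodMean w g :=
  Finset.sum_le_sum fun C _ =>
    mul_le_mul_of_nonneg_left (h C) (Finset.prod_nonneg fun _ _ => hw.nonneg _)

theorem prodMean_nonneg (hw : IsWeight w) {f : (Fin m → α) → ℝ} (h : ∀ C, 0 ≤ f C) :
    0 ≤ prodMean w f :=
  Finset.sum_nonneg fun C _ => mul_nonneg (Finset.prod_nonneg fun _ _ => hw.nonneg _) (h C)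

theorem prodMean_succ (f : (Fin (m + 1) → α) → ℝ) :
    prodMean w f = ∑ a, w a * prodMean w (fun C => f (Fin.cons a C)) := by
  unfold prodMean
  rw [← Fintype.sum_equiv (Fin.consEquiv fun _ : Fin (m + 1) => α) _ _ (fun _ => rfl),
    Fintype.sum_prod_type]
  refine Finset.sum_congr rfl fun a _ => ?_
  rw [Finset.mul_sum]
  refine Finset.sum_congr rfl fun C _ => ?_
  simp [Fin.consEquiv, Fin.prod_univ_succ, mul_assoc]

theorem prodMean_zero (f : (Fin 0 → α) → ℝ) : prodMean w f = f default := by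
  simp [prodMean]

theorem prodMean_const (hw : IsWeight w) (c : ℝ) : prodMean w (fun _ : Fin m → α => c) = c := by
  induction m with
  | zero => rw [prodMean_zero]
  | succ m ih => rw [prodMean_succ]; simp only [ih]; rw [← Finset.sum_mul, hw.sum_eq, one_mul]

theorem prodMean_comm {β : Type*} [Fintype β] {v : β → ℝ} {n : ℕ}
    (f : (Fin m → α) → (Fin n → β) → ℝ) :
    prodMean w (fun C => prodMean v (fun B => f C B)) =
      prodMean v (fun B => prodMean w (fun C => f C B)) := by
  simp only [prodMean, Finset.mul_sum]
  rw [Finset.sum_comm]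
  exact Finset.sum_congr rfl fun _ _ => Finset.sum_congr rfl fun _ _ => by ring

/-- Resampling one coordinate gives an exchangeable pair. -/
theorem prodMean_exchange (i : Fin m) (F : (Fin m → α) → (Fin m → α) → ℝ) :
    prodMean w (fun C => ∑ a, w a * F C (Function.update C i a)) =
      prodMean w (fun C => ∑ a, w a * F (Function.update C i a) C) := by
  simp only [prodMean, Finset.mul_sum]
  rw [← Fintype.sum_prod_type', ← Fintype.sum_prod_type']
  -- The involution trades the fresh value `a` for the old value `C i`; the product weight of the
  -- pair is unchanged.
  refine Fintype.sum_equiv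
    (Function.Involutive.toPerm (fun p : (Fin m → α) × α => (Function.update p.1 i p.2, p.1 i)) ?_)
    _ _ ?_
  · rintro ⟨C, a⟩
    simp
  · rintro ⟨C, a⟩
    have h : (∏ j, w (C j)) * w a = (∏ j, w (Function.update C i a j)) * w (C i) := by
      rw [← Finset.mul_prod_erase _ _ (Finset.mem_univ i),
        ← Finset.mul_prod_erase Finset.univ (fun j => w (Function.update C i a j))
          (Finset.mem_univ i)]
      have : ∏ j ∈ Finset.univ.erase i, w (Function.update C i a j) =
          ∏ j ∈ Finset.univ.erase i, w (C j) :=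
        Finset.prod_congr rfl fun j hj => by
          rw [Function.update_of_ne (Finset.ne_of_mem_erase hj)]
      rw [this]
      simp only [Function.update_self]
      ring
    rw [← mul_assoc, h, mul_assoc]
    change _ = (∏ j, w (Function.update C i a j)) *
      (w (C i) * F (Function.update (Function.update C i a) i (C i)) (Function.update C i a))
    rw [Function.update_idem, Function.update_eq_self]

/-- Take the coordinates of `C` where `b` holds and those of `C'` elsewhere. -/
def mix (b : Fin m → Bool) (C C' : Fin m → α) : Fin m → α := fun i => if b i then C i else C' i

/-- Trading `C i` for `C' i` on any set of coordinates preserves the joint law of two independent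
samples. Symmetrization uses this to insert signs. -/
theorem prodMean_mix (b : Fin m → Bool) (F : (Fin m → α) → (Fin m → α) → ℝ) :
    prodMean w (fun C => prodMean w fun C' => F (mix b C C') (mix b C' C)) =
      prodMean w (fun C => prodMean w fun C' => F C C') := by
  simp only [prodMean, Finset.mul_sum]
  rw [← Fintype.sum_prod_type', ← Fintype.sum_prod_type']
  refine Fintype.sum_equiv
    (Function.Involutive.toPerm
      (fun p : (Fin m → α) × (Fin m → α) => (mix b p.1 p.2, mix b p.2 p.1)) ?_) _ _ ?_
  · rintro ⟨C, C'⟩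
    ext i <;> simp only [mix] <;> split_ifs <;> rfl
  · rintro ⟨C, C'⟩
    change _ = (∏ i, w (mix b C C' i)) * ((∏ i, w (mix b C' C i)) * F (mix b C C') (mix b C' C))
    simp only [← mul_assoc, ← Finset.prod_mul_distrib]
    congr 1
    refine Finset.prod_congr rfl fun i _ => ?_
    simp only [mix]
    split_ifs
    · rfl
    · ring

end ProdMean

/-! ### The bounded difference inequality. -/

section McDiarmid

variable {α : Type*} [Fintype α] {w : α → ℝ}

/-- Convexity puts `exp` below its chord on `[-c, c]`; centring kills the linear term of the chord
and leaves `cosh c`. -/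
theorem sum_exp_le_of_sum_eq_zero (hw : IsWeight w) {x : α → ℝ} {c : ℝ} (hx : ∀ a, |x a| ≤ c)
    (h0 : ∑ a, w a * x a = 0) : ∑ a, w a * Real.exp (x a) ≤ Real.exp (c ^ 2 / 2) := by
  have hne : Nonempty α := by
    by_contra h
    rw [not_nonempty_iff] at h
    simpa using hw.sum_eq
  obtain ⟨a₀⟩ := hne
  have hc0 : 0 ≤ c := (abs_nonneg _).trans (hx a₀)
  rcases hc0.eq_or_lt with hc | hc
  · have hz : ∀ a, x a = 0 := fun a => abs_eq_zero.mp (le_antisymm (hc ▸ hx a) (abs_nonneg _))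
    simp [hz, ← hc, hw.sum_eq]
  · have key : ∀ a, Real.exp (x a) ≤ Real.cosh c + x a / c * Real.sinh c := by
      intro a
      obtain ⟨h1, h2⟩ := abs_le.mp (hx a)
      have p1 : 0 ≤ (c + x a) / (2 * c) := div_nonneg (by linarith) (by linarith)
      have p2 : 0 ≤ (c - x a) / (2 * c) := div_nonneg (by linarith) (by linarith)
      have := convexOn_exp.2 (Set.mem_univ c) (Set.mem_univ (-c)) p1 p2 (by field_simp; ring)
      simp only [smul_eq_mul] at this
      have e1 : (c + x a) / (2 * c) * c + (c - x a) / (2 * c) * -c = x a := by field_simp; ring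
      rw [e1] at this
      rw [Real.cosh_eq, Real.sinh_eq]
      refine this.trans_eq ?_
      field_simp
      ring
    calc ∑ a, w a * Real.exp (x a) ≤ ∑ a, w a * (Real.cosh c + x a / c * Real.sinh c) :=
          Finset.sum_le_sum fun a _ => mul_le_mul_of_nonneg_left (key a) (hw.nonneg a)
      _ = (∑ a, w a) * Real.cosh c + (∑ a, w a * x a) * (Real.sinh c / c) := by
          rw [Finset.sum_mul, Finset.sum_mul, ← Finset.sum_add_distrib]
          exact Finset.sum_congr rfl fun a _ => by ring
      _ = Real.cosh c := by rw [hw.sum_eq, h0]; ring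
      _ ≤ _ := Real.cosh_le_exp_half_sq c

/-- Doob's martingale, one coordinate at a time: with the first coordinate frozen the induction
hypothesis controls the rest, and the conditional mean `g` stays within `c` of its own mean. Using
this modulus bound rather than the oscillation gives `1/2` in place of the sharp `1/8`. -/
theorem prodMean_exp_le (hw : IsWeight w) {c : ℝ} {m : ℕ} {F : (Fin m → α) → ℝ}
    (hF : ∀ C i a, |F (Function.update C i a) - F C| ≤ c) :
    prodMean w (fun C => Real.exp (F C - prodMean w F)) ≤ Real.exp (m * c ^ 2 / 2) := by
  induction m with
  | zero => simp [prodMean_zero]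
  | succ m ih =>
    set g : α → ℝ := fun a => prodMean w (fun C => F (Fin.cons a C)) with hg
    have hgm : prodMean w F = ∑ a, w a * g a := prodMean_succ F
    have hgd : ∀ a b, |g a - g b| ≤ c := by
      intro a b
      have hd : ∀ C : Fin m → α, |F (Fin.cons a C) - F (Fin.cons b C)| ≤ c := fun C => by
        simpa using hF (Fin.cons b C) 0 a
      rw [abs_le]
      constructor
      · have := prodMean_mono hw fun C => (abs_le.mp (hd C)).1
        rw [prodMean_const hw, prodMean_sub] at this
        exact this
      · have := prodMean_mono hw fun C => (abs_le.mp (hd C)).2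
        rw [prodMean_const hw, prodMean_sub] at this
        exact this
    have hstep : ∀ a, prodMean w (fun C => Real.exp (F (Fin.cons a C) - prodMean w F)) ≤
        Real.exp (m * c ^ 2 / 2) * Real.exp (g a - prodMean w F) := by
      intro a
      have h1 : ∀ C : Fin m → α, Real.exp (F (Fin.cons a C) - prodMean w F) =
          Real.exp (g a - prodMean w F) * Real.exp (F (Fin.cons a C) - g a) := fun C => by
        rw [← Real.exp_add]; congr 1; ring
      simp only [h1]
      rw [prodMean_const_mul, mul_comm]
      refine mul_le_mul_of_nonneg_right (ih fun C i b => ?_) (Real.exp_pos _).le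
      have := hF (Fin.cons a C) i.succ b
      rwa [← Fin.cons_update] at this
    rw [prodMean_succ]
    calc _ ≤ ∑ a, w a * (Real.exp (m * c ^ 2 / 2) * Real.exp (g a - prodMean w F)) :=
          Finset.sum_le_sum fun a _ => mul_le_mul_of_nonneg_left (hstep a) (hw.nonneg a)
      _ = Real.exp (m * c ^ 2 / 2) * ∑ a, w a * Real.exp (g a - prodMean w F) := by
          rw [Finset.mul_sum]
          exact Finset.sum_congr rfl fun a _ => by ring
      _ ≤ Real.exp (m * c ^ 2 / 2) * Real.exp (c ^ 2 / 2) := by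
          refine mul_le_mul_of_nonneg_left (sum_exp_le_of_sum_eq_zero hw (fun a => ?_) ?_)
            (Real.exp_pos _).le
          · have e : g a - prodMean w F = ∑ b, w b * (g a - g b) := by
              simp only [mul_sub, Finset.sum_sub_distrib, ← Finset.sum_mul, hw.sum_eq, one_mul, hgm]
            rw [e]
            calc |∑ b, w b * (g a - g b)| ≤ ∑ b, |w b * (g a - g b)| :=
                  Finset.abs_sum_le_sum_abs _ _
              _ ≤ ∑ b, w b * c := Finset.sum_le_sum fun b _ => by
                  rw [abs_mul, abs_of_nonneg (hw.nonneg b)]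
                  exact mul_le_mul_of_nonneg_left (hgd a b) (hw.nonneg b)
              _ = c := by rw [← Finset.sum_mul, hw.sum_eq, one_mul]
          · simp only [mul_sub, Finset.sum_sub_distrib, ← Finset.sum_mul, hw.sum_eq, one_mul, hgm]
            ring
      _ = _ := by rw [← Real.exp_add]; push_cast; congr 1; ring

/-- McDiarmid's bounded difference inequality. -/
theorem prodMean_indicator_le (hw : IsWeight w) {c t : ℝ} (hc : 0 < c) (ht : 0 ≤ t) {m : ℕ}
    (hm : 0 < m) {F : (Fin m → α) → ℝ} (hF : ∀ C i a, |F (Function.update C i a) - F C| ≤ c)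
    (S : Set (Fin m → α)) (hS : ∀ C ∈ S, prodMean w F + t ≤ F C) :
    prodMean w (S.indicator 1) ≤ Real.exp (-(t ^ 2 / (2 * m * c ^ 2))) := by
  have hm' : (0 : ℝ) < m := by exact_mod_cast hm
  -- The Chernoff parameter minimizing `-l * t + m * l ^ 2 * c ^ 2 / 2`.
  set l : ℝ := t / (m * c ^ 2) with hl
  have hl0 : 0 ≤ l := by positivity
  have h1 : prodMean w (S.indicator 1) ≤
      prodMean w (fun C => Real.exp (-(l * t)) *
        Real.exp (l * F C - prodMean w (fun C => l * F C))) := by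
    refine prodMean_mono hw fun C => ?_
    by_cases hC : C ∈ S
    · rw [Set.indicator_of_mem hC, Pi.one_apply, ← Real.exp_add, prodMean_const_mul]
      refine Real.one_le_exp ?_
      have := mul_le_mul_of_nonneg_left (hS C hC) hl0
      linarith
    · rw [Set.indicator_of_notMem hC]; positivity
  rw [prodMean_const_mul] at h1
  have h2 := prodMean_exp_le hw (c := l * c) (F := fun C => l * F C) (fun C i a => by
    rw [← mul_sub, abs_mul, abs_of_nonneg hl0]
    exact mul_le_mul_of_nonneg_left (hF C i a) hl0)
  refine h1.trans ((mul_le_mul_of_nonneg_left h2 (Real.exp_pos _).le).trans_eq ?_)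
  rw [← Real.exp_add, hl]
  congr 1
  field_simp
  ring

end McDiarmid

/-! ### Random signs and the contraction principle. -/

section Rademacher

/-- The sign of a boolean. -/
def sgn (b : Bool) : ℝ := if b then 1 else -1

theorem isWeight_half : IsWeight (fun _ : Bool => (1 / 2 : ℝ)) :=
  ⟨fun _ => by norm_num, by simp⟩

/-- The mean over independent random signs. -/
noncomputable abbrev signMean {m : ℕ} (f : (Fin m → Bool) → ℝ) : ℝ :=
  prodMean (fun _ : Bool => (1 / 2 : ℝ)) f

theorem signMean_not {m : ℕ} (f : (Fin m → Bool) → ℝ) :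
    signMean (fun b => f fun i => !b i) = signMean f := by
  unfold signMean prodMean
  refine Fintype.sum_equiv (Function.Involutive.toPerm (fun (b : Fin m → Bool) i => !b i) ?_) _ _ ?_
  · intro b; ext i; simp
  · intro b; simp only [Finset.prod_const]; rfl

theorem signMean_sum_sq (m : ℕ) (x : ℝ) :
    signMean (fun b : Fin m → Bool => (x + ∑ i, sgn (b i)) ^ 2) = x ^ 2 + m := by
  induction m generalizing x with
  | zero => rw [signMean, prodMean_zero]; simp
  | succ m ih =>
    rw [signMean, prodMean_succ]
    simp only [Fin.sum_univ_succ, Fin.cons_zero, Fin.cons_succ, ← add_assoc]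
    simp only [signMean] at ih
    simp only [ih, Fintype.sum_bool]
    simp only [sgn]
    push_cast
    simp
    ring

/-- The second moment of the sum is `m`; the inequality `y ≤ y² / (2√m) + √m / 2` takes the place of
Cauchy–Schwarz. -/
theorem signMean_abs_sum_le (m : ℕ) :
    signMean (fun b : Fin m → Bool => |∑ i, sgn (b i)|) ≤ Real.sqrt m := by
  rcases Nat.eq_zero_or_pos m with rfl | hm
  · simp [signMean, prodMean_zero]
  have hs : 0 < Real.sqrt m := Real.sqrt_pos.mpr (by exact_mod_cast hm)
  have h1 : signMean (fun b : Fin m → Bool => |∑ i, sgn (b i)|) ≤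
      signMean (fun b : Fin m → Bool => (1 / (2 * Real.sqrt m)) * (0 + ∑ i, sgn (b i)) ^ 2 +
        Real.sqrt m / 2) := by
    refine prodMean_mono isWeight_half fun b => ?_
    rw [zero_add, ← sq_abs (∑ i, sgn (b i))]
    set y := |∑ i, sgn (b i)|
    have : 0 ≤ (y - Real.sqrt m) ^ 2 / (2 * Real.sqrt m) := by positivity
    have e : (y - Real.sqrt m) ^ 2 / (2 * Real.sqrt m) =
      1 / (2 * Real.sqrt m) * y ^ 2 + Real.sqrt m / 2 - y := by field_simp; ring
    linarith
  refine h1.trans_eq ?_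
  rw [signMean, prodMean_add, prodMean_const_mul, prodMean_const isWeight_half]
  have := signMean_sum_sq m 0
  simp only [signMean] at this
  rw [this]
  have hsq := Real.sq_sqrt (Nat.cast_nonneg (α := ℝ) m)
  field_simp
  nlinarith

variable {T : Type*}

/-- Contraction for a single sign. The two suprema on the left are nearly attained at points `s` and
`t`; the sign of `g s - g t` decides which supremum on the right is tested at `s` and which at `t`.
-/
theorem iSup_add_iSup_sub_le [Nonempty T] {a f g : T → ℝ} (h : ∀ s t, f s - f t ≤ |g s - g t|)
    (h1 : BddAbove (Set.range fun t => a t + g t)) (h2 : BddAbove (Set.range fun t => a t - g t)) :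
    (⨆ t, (a t + f t)) + ⨆ t, (a t - f t) ≤ (⨆ t, (a t + g t)) + ⨆ t, (a t - g t) := by
  have key : ∀ s t, a s + f s + (a t - f t) ≤ (⨆ t, (a t + g t)) + ⨆ t, (a t - g t) := by
    intro s t
    have := h s t
    rcases abs_cases (g s - g t) with ⟨e, _⟩ | ⟨e, _⟩
    · linarith [le_ciSup h1 s, le_ciSup h2 t]
    · linarith [le_ciSup h1 t, le_ciSup h2 s]
  have h3 : ∀ t, (⨆ s, (a s + f s)) ≤ (⨆ t, (a t + g t)) + (⨆ t, (a t - g t)) - (a t - f t) :=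
    fun t => ciSup_le fun s => by linarith [key s t]
  have h4 : (⨆ t, (a t - f t)) ≤
      (⨆ t, (a t + g t)) + (⨆ t, (a t - g t)) - ⨆ s, (a s + f s) :=
    ciSup_le fun t => by linarith [h3 t]
  linarith

theorem bddAbove_range_of_abs_le {f : T → ℝ} {K : ℝ} (h : ∀ t, |f t| ≤ K) :
    BddAbove (Set.range f) :=
  ⟨K, by rintro _ ⟨t, rfl⟩; exact (abs_le.mp (h t)).2⟩

theorem abs_add_sum_sgn_le {m : ℕ} {h : ℝ} {g : Fin m → ℝ} {H K : ℝ} (hh : |h| ≤ H)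
    (hg : ∀ i, |g i| ≤ K) (b : Fin m → Bool) : |h + ∑ i, sgn (b i) * g i| ≤ H + m * K := by
  refine (abs_add_le _ _).trans (add_le_add hh ((Finset.abs_sum_le_sum_abs _ _).trans ?_))
  calc ∑ i, |sgn (b i) * g i| ≤ ∑ _i : Fin m, K := Finset.sum_le_sum fun i _ => by
        rw [abs_mul]
        have : |sgn (b i)| = 1 := by cases b i <;> simp [sgn]
        rw [this, one_mul]
        exact hg i
    _ = m * K := by simp

/-- The contraction principle for Rademacher averages. -/
theorem signMean_contraction [Nonempty T] {m : ℕ} {h : T → ℝ} {f g : T → Fin m → ℝ} {H K : ℝ}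
    (hh : ∀ t, |h t| ≤ H) (hg : ∀ t i, |g t i| ≤ K) (hf : ∀ t i, |f t i| ≤ K)
    (hfg : ∀ s t i, f s i - f t i ≤ |g s i - g t i|) :
    signMean (fun b => ⨆ t, (h t + ∑ i, sgn (b i) * f t i)) ≤
      signMean (fun b => ⨆ t, (h t + ∑ i, sgn (b i) * g t i)) := by
  induction m generalizing h H with
  | zero => simp [signMean, prodMean_zero]
  | succ m ih =>
    simp only [signMean]
    rw [prodMean_succ, prodMean_succ]
    simp only [Fintype.sum_bool, Fin.sum_univ_succ, Fin.cons_zero, Fin.cons_succ, sgn, if_true,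
      Bool.false_eq_true, if_false, one_mul, neg_one_mul]
    rw [← mul_add, ← mul_add, ← prodMean_add, ← prodMean_add]
    refine mul_le_mul_of_nonneg_left ?_ (by norm_num)
    have hb1 : ∀ t, |h t + f t 0| ≤ H + K := fun t =>
      (abs_add_le _ _).trans (add_le_add (hh t) (hf t 0))
    have hb2 : ∀ t, |h t + -f t 0| ≤ H + K := fun t =>
      (abs_add_le _ _).trans (add_le_add (hh t) ((abs_neg _).trans_le (hf t 0)))
    -- The offset `h` absorbs `± f t 0`, so the induction hypothesis replaces `f` by `g` in the
    -- later coordinates. The first coordinate is then replaced with the later signs held fixed.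
    have i1 := ih hb1 (f := fun t i => f t i.succ) (g := fun t i => g t i.succ)
      (fun t i => hg t _) (fun t i => hf t _) (fun s t i => hfg s t _)
    have i2 := ih hb2 (f := fun t i => f t i.succ) (g := fun t i => g t i.succ)
      (fun t i => hg t _) (fun t i => hf t _) (fun s t i => hfg s t _)
    simp only [signMean] at i1 i2
    have i3 := add_le_add i1 i2
    rw [← prodMean_add, ← prodMean_add] at i3
    simp only [sgn] at i3
    simp only [← add_assoc]
    refine i3.trans (prodMean_mono isWeight_half fun b => ?_)
    have hbd : ∀ t, |h t + ∑ i, sgn (b i) * g t i.succ| ≤ H + m * K := fun t =>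
      abs_add_sum_sgn_le (hh t) (fun i => hg t i.succ) b
    have h5 := iSup_add_iSup_sub_le (a := fun t => h t + ∑ i, sgn (b i) * g t i.succ)
      (f := fun t => f t 0) (g := fun t => g t 0) (fun s t => hfg s t 0)
      (bddAbove_range_of_abs_le (K := H + m * K + K)
        fun t => (abs_add_le _ _).trans (add_le_add (hbd t) (hg t 0)))
      (bddAbove_range_of_abs_le (K := H + m * K + K)
        fun t => (abs_sub _ _).trans (add_le_add (hbd t) (hg t 0)))
    simp only [sgn] at h5
    convert h5 using 4 <;> ring

end Rademacher

/-! ### Uniform lower bounds for empirical second moments. -/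

section Symmetrization

variable {α : Type*} [Fintype α] {w : α → ℝ} {m : ℕ} {T : Type*} [Nonempty T]

theorem prodMean_eval (hw : IsWeight w) (i : Fin m) (f : α → ℝ) :
    prodMean w (fun C => f (C i)) = ∑ a, w a * f a := by
  have h := prodMean_exchange (w := w) i fun C _ => f (C i)
  simp only [Function.update_self, prodMean_const hw, ← Finset.sum_mul, hw.sum_eq, one_mul] at h
  exact h

theorem iSup_prodMean_le (hw : IsWeight w) {G : T → (Fin m → α) → ℝ} {K : ℝ}
    (hG : ∀ t C, |G t C| ≤ K) : ⨆ t, prodMean w (G t) ≤ prodMean w fun C => ⨆ t, G t C :=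
  ciSup_le fun t => prodMean_mono hw fun C =>
    le_ciSup (f := fun t => G t C) (bddAbove_range_of_abs_le fun t => hG t C) t

theorem abs_sum_sgn_le {g : Fin m → ℝ} {K : ℝ} (hg : ∀ i, |g i| ≤ K) (b : Fin m → Bool) :
    |∑ i, sgn (b i) * g i| ≤ m * K := by
  simpa using abs_add_sum_sgn_le (h := 0) (H := 0) (by simp) hg b

/-- Symmetrization of a one-sided empirical process. -/
theorem prodMean_symmetrization (hw : IsWeight w) {x : T → α → ℝ} {K : ℝ}
    (hx : ∀ t a, |x t a| ≤ K) :
    prodMean w (fun C : Fin m → α => ⨆ t, ∑ i, ((∑ a, w a * x t a) - x t (C i))) ≤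
      2 * prodMean w (fun C : Fin m → α =>
        signMean fun b : Fin m → Bool => ⨆ t, ∑ i, sgn (b i) * x t (C i)) := by
  set G : T → (Fin m → α) → (Fin m → α) → ℝ := fun t C C' => ∑ i, (x t (C' i) - x t (C i)) with hGd
  have hG : ∀ t C C', |G t C C'| ≤ m * (2 * K) := by
    intro t C C'
    have := abs_sum_sgn_le (K := 2 * K) (g := fun i => x t (C' i) - x t (C i))
      (fun i => (abs_sub _ _).trans (by linarith [hx t (C' i), hx t (C i)])) (fun _ => true)
    simpa [sgn, hGd] using this
  have hmean : ∀ t (C : Fin m → α), ∑ i, ((∑ a, w a * x t a) - x t (C i)) =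
      prodMean w (G t C) := by
    intro t C
    simp only [hGd]
    rw [prodMean_sum]
    refine Finset.sum_congr rfl fun i _ => ?_
    rw [prodMean_sub, prodMean_const hw, prodMean_eval hw]
  set Ψ : (Fin m → Bool) → ℝ := fun b =>
    prodMean w fun C : Fin m → α => ⨆ t, ∑ i, sgn (b i) * x t (C i) with hΨ
  have hbdd : ∀ (b : Fin m → Bool) (C : Fin m → α),
      BddAbove (Set.range fun t => ∑ i, sgn (b i) * x t (C i)) := fun b C =>
    bddAbove_range_of_abs_le fun t => abs_sum_sgn_le (fun i => hx t (C i)) b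
  have hb : ∀ b : Fin m → Bool,
      prodMean w (fun C : Fin m → α => ⨆ t, ∑ i, ((∑ a, w a * x t a) - x t (C i))) ≤
        Ψ b + Ψ fun i => !b i := by
    -- For every fixed `b`, swapping the two samples where `b` is false turns `G` into `∑ sgn (b i)
    -- * (x (C' i) - x (C i))`. The supremum then splits into two halves, which agree after
    -- averaging over `b`.
    intro b
    calc _ ≤ prodMean w (fun C => prodMean w fun C' => ⨆ t, G t C C') :=
          prodMean_mono hw fun C => by
            simp only [hmean]
            exact iSup_prodMean_le hw fun t C' => hG t C C'
      _ = prodMean w (fun C => prodMean w fun C' => ⨆ t, G t (mix b C C') (mix b C' C)) :=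
          (prodMean_mix b _).symm
      _ ≤ prodMean w (fun C => prodMean w fun C' =>
            (⨆ t, ∑ i, sgn (b i) * x t (C' i)) + ⨆ t, ∑ i, sgn (!b i) * x t (C i)) := by
          refine prodMean_mono hw fun C => prodMean_mono hw fun C' => ciSup_le fun t => ?_
          refine le_trans (le_of_eq ?_)
            (add_le_add (le_ciSup (hbdd b C') t) (le_ciSup (hbdd (fun i => !b i) C) t))
          simp only [hGd]
          rw [← Finset.sum_add_distrib]
          refine Finset.sum_congr rfl fun i _ => ?_
          cases h : b i <;> simp [mix, h, sgn] <;> ring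
      _ = _ := by
          simp only [prodMean_add, prodMean_const hw]
          rw [add_comm]
  calc _ = signMean (fun _ : Fin m → Bool =>
        prodMean w (fun C : Fin m → α => ⨆ t, ∑ i, ((∑ a, w a * x t a) - x t (C i)))) :=
        (prodMean_const isWeight_half _).symm
    _ ≤ signMean (fun b => Ψ b + Ψ fun i => !b i) := prodMean_mono isWeight_half hb
    _ = signMean Ψ + signMean Ψ := by
        rw [signMean, prodMean_add]
        congr 1
        exact signMean_not Ψ
    _ = 2 * prodMean w (fun C : Fin m → α =>
          signMean fun b : Fin m → Bool => ⨆ t, ∑ i, sgn (b i) * x t (C i)) := by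
        rw [← two_mul, signMean, hΨ, prodMean_comm]

/-- A uniform lower bound on the empirical second moments of a class of functions whose
Rademacher complexity is small. -/
theorem prodMean_exists_sum_sq_lt_le (hw : IsWeight w) (hm : 0 < m) {q : T → α → ℝ} {ν R : ℝ}
    (hν : 0 < ν) (hq : ∀ t a, |q t a| ≤ ν) (hq2 : ∀ t, 1 ≤ ∑ a, w a * q t a ^ 2)
    (hR : prodMean w (fun C : Fin m → α =>
      signMean fun b : Fin m → Bool => ⨆ t, ∑ i, sgn (b i) * q t (C i)) ≤ R)
    (hRν : 4 * ν * R ≤ m / 3) :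
    prodMean w (Set.indicator {C : Fin m → α | ∃ t, ∑ i, q t (C i) ^ 2 < m / 6} 1) ≤
      Real.exp (-(m / (8 * ν ^ 4))) := by
  have hq' : ∀ t a, q t a ^ 2 ≤ ν ^ 2 := fun t a =>
    sq_le_sq' (abs_le.mp (hq t a)).1 (abs_le.mp (hq t a)).2
  have hqa : ∀ t a, |q t a ^ 2| ≤ ν ^ 2 := fun t a => by
    rw [abs_of_nonneg (sq_nonneg _)]; exact hq' t a
  have hm' : (0 : ℝ) < m := by exact_mod_cast hm
  set F : (Fin m → α) → ℝ := fun C => ⨆ t, ∑ i, ((∑ a, w a * q t a ^ 2) - q t (C i) ^ 2) with hF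
  have hEq : ∀ t, |∑ a, w a * q t a ^ 2| ≤ ν ^ 2 := fun t => by
    rw [abs_of_nonneg (Finset.sum_nonneg fun a _ => mul_nonneg (hw.nonneg a) (sq_nonneg _))]
    calc ∑ a, w a * q t a ^ 2 ≤ ∑ a, w a * ν ^ 2 :=
          Finset.sum_le_sum fun a _ => mul_le_mul_of_nonneg_left (hq' t a) (hw.nonneg a)
      _ = ν ^ 2 := by rw [← Finset.sum_mul, hw.sum_eq, one_mul]
  have hbdd : ∀ C : Fin m → α,
      BddAbove (Set.range fun t => ∑ i, ((∑ a, w a * q t a ^ 2) - q t (C i) ^ 2)) := fun C =>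
    bddAbove_range_of_abs_le (K := m * (2 * ν ^ 2)) fun t => by
      have := abs_sum_sgn_le (K := 2 * ν ^ 2) (g := fun i => (∑ a, w a * q t a ^ 2) - q t (C i) ^ 2)
        (fun i => (abs_sub _ _).trans (by linarith [hEq t, hqa t (C i)])) (fun _ => true)
      simpa [sgn] using this
  -- Symmetrization costs a factor 2, and contraction costs `2 * ν`, the Lipschitz constant of
  -- squaring on `[-ν, ν]`; this accounts for `4 * ν * R`.
  have hEF : prodMean w F ≤ m / 3 := by
    have h1 : ∀ C : Fin m → α, signMean (fun b => ⨆ t, ∑ i, sgn (b i) * q t (C i) ^ 2) ≤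
        2 * ν * signMean (fun b => ⨆ t, ∑ i, sgn (b i) * q t (C i)) := by
      intro C
      have h2 := signMean_contraction (T := T) (m := m) (h := fun _ => 0) (H := 0)
        (f := fun t i => q t (C i) ^ 2) (g := fun t i => 2 * ν * q t (C i)) (K := 2 * ν ^ 2)
        (by simp) (fun t i => by
          rw [abs_mul, abs_of_pos (by positivity : 0 < 2 * ν)]
          nlinarith [hq t (C i)])
        (fun t i => (hqa t (C i)).trans (by nlinarith [sq_nonneg ν]))
        (fun s t i => by
          rw [← mul_sub, abs_mul, abs_of_pos (by positivity : 0 < 2 * ν)]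
          have e : q s (C i) ^ 2 - q t (C i) ^ 2 =
            (q s (C i) + q t (C i)) * (q s (C i) - q t (C i)) := by ring
          rw [e]
          refine (le_abs_self _).trans ?_
          rw [abs_mul]
          refine mul_le_mul_of_nonneg_right ((abs_add_le _ _).trans ?_) (abs_nonneg _)
          linarith [hq s (C i), hq t (C i)])
      simp only [zero_add] at h2
      refine h2.trans_eq ?_
      rw [signMean, ← prodMean_const_mul]
      congr 1
      funext b
      rw [Real.mul_iSup_of_nonneg (by positivity)]
      congr 1
      funext t
      rw [Finset.mul_sum]
      exact Finset.sum_congr rfl fun i _ => by ring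
    have h3 := prodMean_symmetrization (m := m) hw hqa
    have h4 := prodMean_mono (m := m) hw h1
    rw [prodMean_const_mul] at h4
    have h5 : 2 * ν * prodMean w (fun C : Fin m → α =>
      signMean fun b : Fin m → Bool => ⨆ t, ∑ i, sgn (b i) * q t (C i)) ≤ 2 * ν * R :=
      mul_le_mul_of_nonneg_left hR (by positivity)
    linarith
  have hdiff : ∀ C i a, F C ≤ F (Function.update C i a) + ν ^ 2 := by
    intro C i a
    refine ciSup_le fun t => ?_
    have h1 := le_ciSup (hbdd (Function.update C i a)) t
    have h2 : ∑ j, ((∑ a, w a * q t a ^ 2) - q t (C j) ^ 2) ≤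
        ∑ j, ((∑ a, w a * q t a ^ 2) - q t (Function.update C i a j) ^ 2) + ν ^ 2 := by
      rw [← Finset.add_sum_erase _ _ (Finset.mem_univ i),
        ← Finset.add_sum_erase Finset.univ
          (fun j => (∑ a, w a * q t a ^ 2) - q t (Function.update C i a j) ^ 2) (Finset.mem_univ i)]
      have : ∑ j ∈ Finset.univ.erase i, ((∑ a, w a * q t a ^ 2) - q t (Function.update C i a j) ^ 2)
          = ∑ j ∈ Finset.univ.erase i, ((∑ a, w a * q t a ^ 2) - q t (C j) ^ 2) :=
        Finset.sum_congr rfl fun j hj => by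
          rw [Function.update_of_ne (Finset.ne_of_mem_erase hj)]
      rw [this, Function.update_self]
      linarith [hq' t a, sq_nonneg (q t (C i))]
    exact h2.trans (by simpa [hF] using h1)
  have hdiff' : ∀ C i a, |F (Function.update C i a) - F C| ≤ ν ^ 2 := by
    intro C i a
    have h1 := hdiff C i a
    have h2 := hdiff (Function.update C i a) i (C i)
    rw [Function.update_idem, Function.update_eq_self] at h2
    rw [abs_le]
    constructor <;> linarith
  -- On the bad event the deficit is at least `m - m / 6 = m / 3 + m / 2`, so it exceeds its mean by
  -- `t = m / 2`; one coordinate moves it by at most `ν ^ 2` because the squares lie in `[0, ν ^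
  -- 2]`.
  refine (prodMean_indicator_le hw (c := ν ^ 2) (t := m / 2) (by positivity) (by positivity) hm
    hdiff' _ ?_).trans_eq ?_
  · rintro C ⟨t, ht⟩
    have h1 := le_ciSup (hbdd C) t
    have h2 : (m : ℝ) - m / 6 ≤ ∑ i, ((∑ a, w a * q t a ^ 2) - q t (C i) ^ 2) := by
      rw [Finset.sum_sub_distrib]
      have : (m : ℝ) ≤ ∑ _i : Fin m, ∑ a, w a * q t a ^ 2 := by
        rw [Finset.sum_const, Finset.card_univ, Fintype.card_fin, nsmul_eq_mul]
        nlinarith [hq2 t]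
      linarith
    have h3 : (m : ℝ) - m / 6 ≤ F C := h2.trans h1
    linarith
  · congr 2
    field_simp
    ring

end Symmetrization

/-! ### Trace inequalities through pairs of eigenvalues. -/

section TraceInequalities

variable {n : Type*} [Fintype n] [DecidableEq n] {H K : Matrix n n ℂ}

/-- The squared overlaps of the eigenvectors of two Hermitian matrices. -/
noncomputable def overlap (hH : H.IsHermitian) (hK : K.IsHermitian) (i j : n) : ℝ :=
  Complex.normSq ((star (hH.eigenvectorUnitary : Matrix n n ℂ) *
    (hK.eigenvectorUnitary : Matrix n n ℂ)) i j)

theorem overlap_nonneg (hH : H.IsHermitian) (hK : K.IsHermitian) (i j : n) :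
    0 ≤ overlap hH hK i j := Complex.normSq_nonneg _

theorem sum_overlap (hH : H.IsHermitian) (hK : K.IsHermitian) (i : n) :
    ∑ j, overlap hH hK i j = 1 := by
  set W := star hH.eigenvectorUnitary * hK.eigenvectorUnitary with hW
  have h : (W : Matrix n n ℂ) * star (W : Matrix n n ℂ) = 1 := Unitary.coe_mul_star_self W
  have h2 := congrFun (congrFun h i) i
  rw [Matrix.mul_apply] at h2
  have h3 := congrArg Complex.re h2
  simp only [Matrix.star_apply, Complex.star_def, Complex.mul_conj, Complex.re_sum,
    Complex.ofReal_re, Matrix.one_apply_eq, Complex.one_re] at h3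
  exact h3

theorem pow_eq_spectral (hH : H.IsHermitian) (a : ℕ) :
    H ^ a = (hH.eigenvectorUnitary : Matrix n n ℂ) *
      Matrix.diagonal (fun i => ((hH.eigenvalues i : ℝ) : ℂ) ^ a) *
      star (hH.eigenvectorUnitary : Matrix n n ℂ) := by
  conv_lhs => rw [hH.spectral_theorem]
  rw [← map_pow, Unitary.conjStarAlgAut_apply, Matrix.diagonal_pow]
  rfl

theorem trace_conj_diagonal_mul (U V : Matrix n n ℂ) (x y : n → ℂ) :
    (U * Matrix.diagonal x * star U * (V * Matrix.diagonal y * star V)).trace =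
      ∑ i, ∑ j, (Complex.normSq ((star U * V) i j) : ℂ) * (x i * y j) := by
  have h1 : (U * Matrix.diagonal x * star U * (V * Matrix.diagonal y * star V)).trace =
      ((Matrix.diagonal x * (star U * V)) * (Matrix.diagonal y * star (star U * V))).trace := by
    rw [star_mul, star_star]
    generalize Matrix.diagonal x = D
    generalize Matrix.diagonal y = E
    generalize star U = U'
    generalize star V = V'
    calc _ = (U * (D * U' * (V * E * V'))).trace := by simp only [mul_assoc]
      _ = ((D * U' * (V * E * V')) * U).trace := Matrix.trace_mul_comm _ _
      _ = _ := by simp only [mul_assoc]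
  rw [h1, Matrix.trace]
  refine Finset.sum_congr rfl fun i _ => ?_
  rw [Matrix.diag_apply, Matrix.mul_apply]
  refine Finset.sum_congr rfl fun j _ => ?_
  rw [Matrix.diagonal_mul, Matrix.diagonal_mul, Matrix.star_apply, ← Complex.mul_conj,
    Complex.star_def]
  ring

/-- The weights are nonnegative and do not depend on the exponents, so scalar inequalities between
eigenvalue pairs transfer to traces even though `H` and `K` need not commute. -/
theorem trace_pow_mul_pow (hH : H.IsHermitian) (hK : K.IsHermitian) (a b : ℕ) :
    (H ^ a * K ^ b).trace.re =
      ∑ i, ∑ j, overlap hH hK i j * (hH.eigenvalues i ^ a * hK.eigenvalues j ^ b) := by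
  rw [pow_eq_spectral hH a, pow_eq_spectral hK b, trace_conj_diagonal_mul]
  simp only [← Complex.ofReal_pow, ← Complex.ofReal_mul, ← Complex.ofReal_sum, Complex.ofReal_re]
  rfl

theorem trace_pow_eq_sum (hH : H.IsHermitian) (a : ℕ) :
    (H ^ a).trace.re = ∑ i, hH.eigenvalues i ^ a := by
  have h := trace_pow_mul_pow hH hH a 0
  simp only [pow_zero, mul_one] at h
  rw [h]
  exact Finset.sum_congr rfl fun i _ => by rw [← Finset.sum_mul, sum_overlap, one_mul]

/-- The difference of powers factors as `x - y` times `2r + 1` monomials of degree `2r`; each is at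
most the larger of the two even powers. -/
theorem sub_mul_pow_sub_pow_le (x y : ℝ) (r : ℕ) :
    (x - y) * (x ^ (2 * r + 1) - y ^ (2 * r + 1)) ≤
      (2 * r + 1) * ((x - y) ^ 2 * (x ^ (2 * r) + y ^ (2 * r))) := by
  have h : ∑ i ∈ Finset.range (2 * r + 1), x ^ i * y ^ (2 * r + 1 - 1 - i) ≤
      (2 * r + 1) * (x ^ (2 * r) + y ^ (2 * r)) := by
    calc _ ≤ ∑ i ∈ Finset.range (2 * r + 1), (x ^ (2 * r) + y ^ (2 * r)) := by
          refine Finset.sum_le_sum fun i hi => ?_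
          have hi' : i + (2 * r + 1 - 1 - i) = 2 * r := by
            have := Finset.mem_range.mp hi
            omega
          set k := 2 * r + 1 - 1 - i
          have hx : |x| ^ (2 * r) = x ^ (2 * r) := (even_two_mul r).pow_abs x
          have hy : |y| ^ (2 * r) = y ^ (2 * r) := (even_two_mul r).pow_abs y
          refine (le_abs_self _).trans ?_
          rw [abs_mul, abs_pow, abs_pow, ← hx, ← hy]
          rcases le_total |x| |y| with hxy | hxy
          · calc |x| ^ i * |y| ^ k ≤ |y| ^ i * |y| ^ k := by gcongr
              _ = |y| ^ (2 * r) := by rw [← pow_add, hi']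
              _ ≤ _ := le_add_of_nonneg_left (by positivity)
          · calc |x| ^ i * |y| ^ k ≤ |x| ^ i * |x| ^ k := by gcongr
              _ = |x| ^ (2 * r) := by rw [← pow_add, hi']
              _ ≤ _ := le_add_of_nonneg_right (by positivity)
      _ = _ := by rw [Finset.sum_const, Finset.card_range, nsmul_eq_mul]; push_cast; ring
  rw [← (Commute.all x y).mul_geom_sum₂]
  calc _ = (x - y) ^ 2 * ∑ i ∈ Finset.range (2 * r + 1), x ^ i * y ^ (2 * r + 1 - 1 - i) := by ring
    _ ≤ (x - y) ^ 2 * ((2 * r + 1) * (x ^ (2 * r) + y ^ (2 * r))) :=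
        mul_le_mul_of_nonneg_left h (sq_nonneg _)
    _ = _ := by ring

/-- The mean value trace inequality for odd powers. -/
theorem trace_sub_mul_pow_sub_pow_le (hH : H.IsHermitian) (hK : K.IsHermitian) (r : ℕ) :
    ((H - K) * (H ^ (2 * r + 1) - K ^ (2 * r + 1))).trace.re ≤
      (2 * r + 1) * (((H - K) ^ 2 * (H ^ (2 * r) + K ^ (2 * r))).trace.re) := by
  have e1 : ((H - K) * (H ^ (2 * r + 1) - K ^ (2 * r + 1))).trace.re =
      (H ^ (2 * r + 2) * K ^ 0).trace.re - (H ^ 1 * K ^ (2 * r + 1)).trace.re -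
        (H ^ (2 * r + 1) * K ^ 1).trace.re + (H ^ 0 * K ^ (2 * r + 2)).trace.re := by
    rw [sub_mul, mul_sub, mul_sub, Matrix.trace_sub, Matrix.trace_sub, Matrix.trace_sub,
      Matrix.trace_mul_comm K (H ^ _), ← pow_succ', ← pow_succ']
    simp only [pow_zero, one_mul, mul_one, pow_one, Complex.sub_re]
    ring
  have e2 : ((H - K) ^ 2 * (H ^ (2 * r) + K ^ (2 * r))).trace.re =
      (H ^ (2 * r + 2) * K ^ 0).trace.re - 2 * (H ^ (2 * r + 1) * K ^ 1).trace.re +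
        (H ^ (2 * r) * K ^ 2).trace.re + ((H ^ 2 * K ^ (2 * r)).trace.re -
        2 * (H ^ 1 * K ^ (2 * r + 1)).trace.re + (H ^ 0 * K ^ (2 * r + 2)).trace.re) := by
    have t1 : (H * (K * H ^ (2 * r))).trace = (H ^ (2 * r + 1) * K ^ 1).trace := by
      rw [← mul_assoc, Matrix.trace_mul_comm, ← mul_assoc, ← pow_succ, pow_one]
    have t2 : (K * (H * H ^ (2 * r))).trace = (H ^ (2 * r + 1) * K ^ 1).trace := by
      rw [Matrix.trace_mul_comm, ← pow_succ', pow_one]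
    have t3 : (K * (K * H ^ (2 * r))).trace = (H ^ (2 * r) * K ^ 2).trace := by
      rw [← mul_assoc, Matrix.trace_mul_comm, ← pow_two]
    have t4 : (K * (H * K ^ (2 * r))).trace = (H ^ 1 * K ^ (2 * r + 1)).trace := by
      rw [Matrix.trace_mul_comm, mul_assoc, ← pow_succ, pow_one]
    have t5 : H * (K * K ^ (2 * r)) = H ^ 1 * K ^ (2 * r + 1) := by rw [← pow_succ', pow_one]
    have t6 : H * (H * K ^ (2 * r)) = H ^ 2 * K ^ (2 * r) := by rw [← mul_assoc, ← pow_two]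
    have t7 : H * (H * H ^ (2 * r)) = H ^ (2 * r + 2) * K ^ 0 := by
      rw [← pow_succ', ← pow_succ', pow_zero, mul_one]
    have t8 : K * (K * K ^ (2 * r)) = H ^ 0 * K ^ (2 * r + 2) := by
      rw [← pow_succ', ← pow_succ', pow_zero, one_mul]
    rw [pow_two (H - K)]
    simp only [sub_mul, mul_sub, mul_add, Matrix.trace_sub, Matrix.trace_add, mul_assoc, t1, t2, t3,
      t4, t5, t6, t7, t8, Complex.sub_re, Complex.add_re]
    ring
  rw [e1, e2]
  simp only [trace_pow_mul_pow hH hK, Finset.mul_sum, ← Finset.sum_sub_distrib,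
    ← Finset.sum_add_distrib]
  refine Finset.sum_le_sum fun i _ => Finset.sum_le_sum fun j _ => ?_
  have h := mul_le_mul_of_nonneg_left
    (sub_mul_pow_sub_pow_le (hH.eigenvalues i) (hK.eigenvalues j) r) (overlap_nonneg hH hK i j)
  refine le_trans (le_of_eq ?_) (h.trans (le_of_eq ?_)) <;> ring

theorem trace_sq_mul_pow_nonneg {B X : Matrix n n ℂ} (hB : B.IsHermitian) (hX : X.IsHermitian)
    (r : ℕ) : 0 ≤ (B ^ 2 * X ^ (2 * r)).trace.re := by
  have h := (Matrix.posSemidef_conjTranspose_mul_self (B * X ^ r)).trace_nonneg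
  rw [Matrix.conjTranspose_mul, hB.eq, (hX.pow r).eq, mul_assoc, Matrix.trace_mul_comm, mul_assoc,
    mul_assoc, ← pow_add, ← mul_assoc, ← pow_two, ← two_mul] at h
  exact (Complex.le_def.mp h).1

theorem trace_pow_even_nonneg {X : Matrix n n ℂ} (hX : X.IsHermitian) (r : ℕ) :
    0 ≤ (X ^ (2 * r)).trace.re := by
  have := trace_sq_mul_pow_nonneg Matrix.isHermitian_one hX r
  simpa using this

/-- Summing `λ ^ (2r) * (λ - k) ^ 2 ≥ 0` over the eigenvalues. This lets an odd moment be absorbed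
into the neighbouring even ones. -/
theorem trace_pow_odd_le {X : Matrix n n ℂ} (hX : X.IsHermitian) (r : ℕ) (k : ℝ) :
    2 * k * (X ^ (2 * r + 1)).trace.re ≤
      (X ^ (2 * r + 2)).trace.re + k ^ 2 * (X ^ (2 * r)).trace.re := by
  rw [trace_pow_eq_sum hX, trace_pow_eq_sum hX, trace_pow_eq_sum hX, Finset.mul_sum,
    Finset.mul_sum, ← Finset.sum_add_distrib]
  refine Finset.sum_le_sum fun i _ => ?_
  have h : 0 ≤ (hX.eigenvalues i ^ r) ^ 2 * (hX.eigenvalues i - k) ^ 2 := by positivity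
  have e : (hX.eigenvalues i ^ r) ^ 2 * (hX.eigenvalues i - k) ^ 2 =
    hX.eigenvalues i ^ (2 * r + 2) + k ^ 2 * hX.eigenvalues i ^ (2 * r) -
      2 * k * hX.eigenvalues i ^ (2 * r + 1) := by ring
  linarith

/-- A bound affine in the trace moment: its mean can be taken directly, with no root to extract. The
threshold `s` is later the expected size of the norm. -/
theorem abs_eigenvalues_le {X : Matrix n n ℂ} (hX : X.IsHermitian) {s : ℝ} (hs : 0 < s) (p : ℕ)
    (j : n) : |hX.eigenvalues j| ≤ s + (X ^ (2 * (p + 1))).trace.re / s ^ (2 * p + 1) := by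
  have h1 : hX.eigenvalues j ^ (2 * (p + 1)) ≤ (X ^ (2 * (p + 1))).trace.re := by
    rw [trace_pow_eq_sum hX]
    exact Finset.single_le_sum (f := fun i => hX.eigenvalues i ^ (2 * (p + 1)))
      (fun i _ => (even_two_mul _).pow_nonneg _) (Finset.mem_univ j)
  rcases le_total |hX.eigenvalues j| s with h | h
  · exact h.trans (le_add_of_nonneg_right
      (div_nonneg (trace_pow_even_nonneg hX _) (by positivity)))
  · have h2 : |hX.eigenvalues j| ≤ (X ^ (2 * (p + 1))).trace.re / s ^ (2 * p + 1) := by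
      rw [le_div_iff₀ (by positivity)]
      refine le_trans ?_ h1
      rw [← (even_two_mul (p + 1)).pow_abs, show 2 * (p + 1) = (2 * p + 1) + 1 by ring,
        pow_succ' |_| (2 * p + 1)]
      gcongr
    linarith

/-- Duality between the trace norm and the operator norm of Hermitian matrices. -/
theorem abs_trace_mul_le {Z M : Matrix n n ℂ} (hZ : Z.IsHermitian) (hM : M.IsHermitian) {b : ℝ}
    (hb : ∀ j, |hM.eigenvalues j| ≤ b) :
    |(Z * M).trace.re| ≤ (∑ i, |hZ.eigenvalues i|) * b := by
  have h := trace_pow_mul_pow hZ hM 1 1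
  simp only [pow_one] at h
  rw [h, Finset.sum_mul]
  refine (Finset.abs_sum_le_sum_abs _ _).trans (Finset.sum_le_sum fun i _ => ?_)
  calc _ ≤ ∑ j, |overlap hZ hM i j * (hZ.eigenvalues i * hM.eigenvalues j)| :=
        Finset.abs_sum_le_sum_abs _ _
    _ ≤ ∑ j, overlap hZ hM i j * (|hZ.eigenvalues i| * b) := by
        refine Finset.sum_le_sum fun j _ => ?_
        rw [abs_mul, abs_mul, abs_of_nonneg (overlap_nonneg hZ hM i j)]
        have := hb j
        have := overlap_nonneg hZ hM i j
        gcongr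
    _ = |hZ.eigenvalues i| * b := by rw [← Finset.sum_mul, sum_overlap, one_mul]

end TraceInequalities

/-! ### Even moments of random matrix sums by exchangeable pairs. -/

section MatrixMoments

variable {n : Type*} [DecidableEq n] {α : Type*} {w : α → ℝ} {m : ℕ}

/-- The centred partial sums of independent random matrices of mean `1`. -/
noncomputable def centredSum (A : α → Matrix n n ℂ) (P : Finset (Fin m)) (C : Fin m → α) :
    Matrix n n ℂ := ∑ i ∈ P, (A (C i) - 1)

variable {A : α → Matrix n n ℂ}

theorem centredSum_isHermitian (hA : ∀ a, (A a).IsHermitian) (P : Finset (Fin m))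
    (C : Fin m → α) : (centredSum A P C).IsHermitian := by
  unfold centredSum
  rw [Matrix.IsHermitian, Matrix.conjTranspose_sum]
  exact Finset.sum_congr rfl fun i _ => ((hA _).sub Matrix.isHermitian_one).eq

theorem centredSum_sub_update {P : Finset (Fin m)} {i : Fin m} (hi : i ∈ P) (C : Fin m → α)
    (a : α) : centredSum A P C - centredSum A P (Function.update C i a) = A (C i) - A a := by
  unfold centredSum
  rw [← Finset.sum_sub_distrib, Finset.sum_eq_single i]
  · simp
  · intro j _ hj
    simp [Function.update_of_ne hj]
  · exact fun h => absurd hi h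

variable [Fintype n] [Fintype α]

theorem sum_mul_trace_mul (B : α → Matrix n n ℂ) (M : Matrix n n ℂ) :
    ∑ a, w a * (B a * M).trace.re = ((∑ a, (w a : ℂ) • B a) * M).trace.re := by
  rw [Finset.sum_mul, Matrix.trace_sum, Complex.re_sum]
  refine Finset.sum_congr rfl fun a _ => ?_
  rw [smul_mul_assoc, Matrix.trace_smul, smul_eq_mul, Complex.re_ofReal_mul]

/-- `P` and `P` with its arguments swapped have the same mean over an exchangeable pair, so
comparing symmetrized integrands is enough. -/
theorem prodMean_exchange_symm {P Q : (Fin m → α) → (Fin m → α) → ℝ} (i : Fin m)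
    (h : ∀ C a, P C (Function.update C i a) + P (Function.update C i a) C ≤
      Q C (Function.update C i a) + Q (Function.update C i a) C) (hw : IsWeight w) :
    prodMean w (fun C => ∑ a, w a * P C (Function.update C i a)) ≤
      prodMean w (fun C => ∑ a, w a * Q C (Function.update C i a)) := by
  have h1 := prodMean_exchange (w := w) i P
  have h2 := prodMean_exchange (w := w) i Q
  have h3 := prodMean_mono hw fun C => Finset.sum_le_sum fun a (_ : a ∈ Finset.univ) =>
    mul_le_mul_of_nonneg_left (h C a) (hw.nonneg a)
  simp only [mul_add, Finset.sum_add_distrib, prodMean_add] at h3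
  linarith

/-- Resample the `i`-th draw. The centred factor is uncorrelated with the power of the resampled
sum, so that power may be subtracted for free. Symmetrizing makes the first factor equal to the
difference of the two sums, and the mean value trace inequality applies. -/
theorem prodMean_trace_centred_mul_pow_le (hw : IsWeight w) (hA : ∀ a, (A a).IsHermitian) {L : ℝ}
    (hL : ∀ a, A a ^ 2 = (L : ℂ) • A a) (hmean : ∑ a, (w a : ℂ) • A a = 1)
    {P : Finset (Fin m)} {i : Fin m} (hi : i ∈ P) (r : ℕ) :
    prodMean w (fun C => ((A (C i) - 1) * centredSum A P C ^ (2 * r + 1)).trace.re) ≤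
      2 * (2 * r + 1) * L *
        prodMean w (fun C => ((A (C i) + 1) * centredSum A P C ^ (2 * r)).trace.re) := by
  set X := centredSum A P with hXdef
  have hX : ∀ C : Fin m → α, (X C).IsHermitian := centredSum_isHermitian hA P
  have hmean0 : ∑ a, (w a : ℂ) • (A a - 1) = 0 := by
    simp only [smul_sub, Finset.sum_sub_distrib, hmean, ← Finset.sum_smul]
    rw [← Complex.ofReal_sum, hw.sum_eq]
    simp
  -- After the exchange the sum is fixed and the centred factor carries the fresh draw, whose mean
  -- is zero.
  have h0 : prodMean w (fun C => ∑ a, w a *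
      ((A (C i) - 1) * X (Function.update C i a) ^ (2 * r + 1)).trace.re) = 0 := by
    rw [prodMean_exchange i (fun C C' => ((A (C i) - 1) * X C' ^ (2 * r + 1)).trace.re)]
    simp only [Function.update_self, sum_mul_trace_mul, hmean0, zero_mul, Matrix.trace_zero,
      Complex.zero_re]
    exact prodMean_const hw 0
  have h1 : prodMean w (fun C => ((A (C i) - 1) * X C ^ (2 * r + 1)).trace.re) =
      prodMean w (fun C => ∑ a, w a * ((A (C i) - 1) *
        (X C ^ (2 * r + 1) - X (Function.update C i a) ^ (2 * r + 1))).trace.re) := by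
    simp only [mul_sub (A _ - 1), Matrix.trace_sub, Complex.sub_re]
    simp only [mul_sub (w _), Finset.sum_sub_distrib, ← Finset.sum_mul, hw.sum_eq, one_mul]
    rw [prodMean_sub, h0, sub_zero]
  have h2 := prodMean_exchange_symm (w := w) i
    (P := fun C C' => ((A (C i) - 1) * (X C ^ (2 * r + 1) - X C' ^ (2 * r + 1))).trace.re)
    (Q := fun C C' => (2 * r + 1) * ((A (C i) - A (C' i)) ^ 2 * X C ^ (2 * r)).trace.re)
    (fun C a => by
      have e : X C - X (Function.update C i a) = A (C i) - A a := centredSum_sub_update hi C a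
      have t := trace_sub_mul_pow_sub_pow_le (hX C) (hX (Function.update C i a)) r
      rw [e] at t
      simp only [Function.update_self]
      refine le_trans (le_of_eq ?_) (t.trans (le_of_eq ?_))
      · rw [← Complex.add_re, ← Matrix.trace_add]
        congr 2
        noncomm_ring
      · rw [← mul_add, ← Complex.add_re, ← Matrix.trace_add]
        congr 3
        noncomm_ring) hw
  rw [h1]
  refine h2.trans ?_
  rw [← prodMean_const_mul]
  refine prodMean_mono hw fun C => ?_
  simp only [Function.update_self]
  -- Adding the nonnegative term with `(A (C i) + A a) ^ 2` cancels the cross terms; the remaining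
  -- squares are linear because `A ^ 2 = L • A`.
  have h3 : ∀ a, ((A (C i) - A a) ^ 2 * X C ^ (2 * r)).trace.re ≤
      2 * L * ((A (C i) * X C ^ (2 * r)).trace.re + (A a * X C ^ (2 * r)).trace.re) := by
    intro a
    have p := trace_sq_mul_pow_nonneg ((hA (C i)).add (hA a)) (hX C) r
    have e : ((A (C i) - A a) ^ 2 * X C ^ (2 * r)).trace.re +
        ((A (C i) + A a) ^ 2 * X C ^ (2 * r)).trace.re =
        2 * L * ((A (C i) * X C ^ (2 * r)).trace.re + (A a * X C ^ (2 * r)).trace.re) := by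
      have e' : (A (C i) - A a) ^ 2 + (A (C i) + A a) ^ 2 =
          ((2 * L : ℝ) : ℂ) • (A (C i) + A a) := by
        have : (A (C i) - A a) ^ 2 + (A (C i) + A a) ^ 2 =
          (2 : ℂ) • (A (C i) ^ 2 + A a ^ 2) := by
          rw [two_smul]; noncomm_ring
        rw [this, hL, hL, ← smul_add, smul_smul]
        push_cast
        rfl
      rw [← Complex.add_re, ← Matrix.trace_add, ← add_mul, e', smul_mul_assoc, Matrix.trace_smul,
        smul_eq_mul, Complex.re_ofReal_mul, add_mul, Matrix.trace_add, Complex.add_re]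
    linarith
  calc _ ≤ ∑ a, w a * ((2 * r + 1) * (2 * L *
        ((A (C i) * X C ^ (2 * r)).trace.re + (A a * X C ^ (2 * r)).trace.re))) := by
        refine Finset.sum_le_sum fun a _ => mul_le_mul_of_nonneg_left ?_ (hw.nonneg a)
        exact mul_le_mul_of_nonneg_left (h3 a) (by positivity)
    _ = 2 * (2 * r + 1) * L * ((∑ a, w a) * (A (C i) * X C ^ (2 * r)).trace.re +
          ∑ a, w a * (A a * X C ^ (2 * r)).trace.re) := by
        rw [Finset.sum_mul, ← Finset.sum_add_distrib, Finset.mul_sum]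
        exact Finset.sum_congr rfl fun a _ => by ring
    _ = _ := by
        rw [hw.sum_eq, one_mul, sum_mul_trace_mul, hmean, ← Complex.add_re, ← Matrix.trace_add,
          ← add_mul]

/-- Summing over `i ∈ P` restores `X` on the left and gives `X + 2 * P.card` on the right, where `X`
is the centred sum. The odd moment is absorbed by `trace_pow_odd_le`: half of it returns to the left
side, hence `k ^ 2 + 4 * k * P.card`. -/
theorem prodMean_trace_pow_succ_le (hw : IsWeight w) (hA : ∀ a, (A a).IsHermitian) {L : ℝ}
    (hL : ∀ a, A a ^ 2 = (L : ℂ) • A a) (hmean : ∑ a, (w a : ℂ) • A a = 1)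
    (P : Finset (Fin m)) (r : ℕ) {k : ℝ} (hk : k = 2 * (2 * r + 1) * L) :
    prodMean w (fun C => (centredSum A P C ^ (2 * r + 2)).trace.re) ≤
      (k ^ 2 + 4 * k * P.card) * prodMean w (fun C => (centredSum A P C ^ (2 * r)).trace.re) := by
  have hX : ∀ C : Fin m → α, (centredSum A P C).IsHermitian := centredSum_isHermitian hA P
  have h1 : prodMean w (fun C => (centredSum A P C ^ (2 * r + 2)).trace.re) =
      ∑ i ∈ P, prodMean w
        (fun C => ((A (C i) - 1) * centredSum A P C ^ (2 * r + 1)).trace.re) := by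
    rw [← prodMean_sum]
    congr 1
    funext C
    rw [← Complex.re_sum, ← Matrix.trace_sum, ← Finset.sum_mul]
    change _ = (centredSum A P C * _).trace.re
    rw [← pow_succ']
  have h2 : ∑ i ∈ P, prodMean w
      (fun C => ((A (C i) + 1) * centredSum A P C ^ (2 * r)).trace.re) =
      prodMean w (fun C => (centredSum A P C ^ (2 * r + 1)).trace.re +
        2 * P.card * (centredSum A P C ^ (2 * r)).trace.re) := by
    rw [← prodMean_sum]
    congr 1
    funext C
    rw [← Complex.re_sum, ← Matrix.trace_sum, ← Finset.sum_mul]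
    have : ∑ i ∈ P, (A (C i) + 1) = centredSum A P C + ((2 * P.card : ℝ) : ℂ) • 1 := by
      unfold centredSum
      rw [Finset.sum_add_distrib, Finset.sum_sub_distrib, Finset.sum_const, ← Nat.cast_smul_eq_nsmul ℂ]
      push_cast
      module
    rw [this, add_mul, Matrix.trace_add, Complex.add_re, ← pow_succ', smul_mul_assoc, one_mul,
      Matrix.trace_smul, smul_eq_mul, Complex.re_ofReal_mul]
  have h3 : prodMean w (fun C => (centredSum A P C ^ (2 * r + 2)).trace.re) ≤
      k * prodMean w (fun C => (centredSum A P C ^ (2 * r + 1)).trace.re +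
        2 * P.card * (centredSum A P C ^ (2 * r)).trace.re) := by
    rw [h1, ← h2, Finset.mul_sum, hk]
    exact Finset.sum_le_sum fun i hi => prodMean_trace_centred_mul_pow_le hw hA hL hmean hi r
  have h4 : 2 * k * prodMean w (fun C => (centredSum A P C ^ (2 * r + 1)).trace.re) ≤
      prodMean w (fun C => (centredSum A P C ^ (2 * r + 2)).trace.re) +
        k ^ 2 * prodMean w (fun C => (centredSum A P C ^ (2 * r)).trace.re) := by
    rw [← prodMean_const_mul, ← prodMean_const_mul, ← prodMean_add]
    exact prodMean_mono hw fun C => trace_pow_odd_le (hX C) r k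
  rw [prodMean_add, prodMean_const_mul] at h3
  linarith

theorem prodMean_trace_pow_le (hw : IsWeight w) (hA : ∀ a, (A a).IsHermitian) {L : ℝ}
    (hL0 : 0 ≤ L) (hL : ∀ a, A a ^ 2 = (L : ℂ) • A a) (hmean : ∑ a, (w a : ℂ) • A a = 1)
    (P : Finset (Fin m)) (p : ℕ) {k : ℝ} (hk : 4 * p * L ≤ k) :
    prodMean w (fun C => (centredSum A P C ^ (2 * p)).trace.re) ≤
      Fintype.card n * (k ^ 2 + 4 * k * m) ^ p := by
  have hP : (P.card : ℝ) ≤ m := by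
    exact_mod_cast (Finset.card_le_univ P).trans_eq (Fintype.card_fin m)
  have hk0 : 0 ≤ k := le_trans (by positivity) hk
  suffices h : ∀ r ≤ p, prodMean w (fun C => (centredSum A P C ^ (2 * r)).trace.re) ≤
      Fintype.card n * (k ^ 2 + 4 * k * m) ^ r from h p le_rfl
  intro r
  induction r with
  | zero => intro _; simp [prodMean_const hw]
  | succ r ih =>
    intro hr
    have hr' : (r : ℝ) + 1 ≤ p := by exact_mod_cast hr
    set k' := 2 * (2 * (r : ℝ) + 1) * L with hk'
    have hk'0 : 0 ≤ k' := by positivity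
    have hkk : k' ≤ k := by nlinarith
    calc _ ≤ (k' ^ 2 + 4 * k' * P.card) *
          prodMean w (fun C => (centredSum A P C ^ (2 * r)).trace.re) :=
          prodMean_trace_pow_succ_le hw hA hL hmean P r hk'
      _ ≤ (k ^ 2 + 4 * k * m) * (Fintype.card n * (k ^ 2 + 4 * k * m) ^ r) := by
          have := ih (by omega)
          have h0 : 0 ≤ prodMean w (fun C => (centredSum A P C ^ (2 * r)).trace.re) :=
            prodMean_nonneg hw fun C => trace_pow_even_nonneg (centredSum_isHermitian hA P C) r
          gcongr
      _ = _ := by ring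

end MatrixMoments

/-! ### The commutant of the tensors `W ⊗ W`. -/

section Commutant

variable {n : Type*} [Fintype n] [DecidableEq n]

/-- A tensor that commutes with `W ⊗ W` for all unitary `W`. -/
def IsConjInvariant (N : n → n → n → n → ℂ) : Prop :=
  ∀ W ∈ Matrix.unitaryGroup n ℂ, ∀ b b' a a', N b b' a a' =
    ∑ x, W b x * ∑ x', W b' x' * ∑ y, star (W a y) * ∑ y', star (W a' y') * N x x' y y'

/-- The monomial matrix of a permutation with given coefficients. -/
def monomialMatrix (σ : Equiv.Perm n) (θ : n → ℂ) : Matrix n n ℂ :=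
  Matrix.of fun b x => if x = σ b then θ b else 0

theorem monomialMatrix_mem (σ : Equiv.Perm n) {θ : n → ℂ} (hθ : ∀ b, θ b * star (θ b) = 1) :
    monomialMatrix σ θ ∈ Matrix.unitaryGroup n ℂ := by
  rw [Matrix.mem_unitaryGroup_iff]
  ext b c
  rw [Matrix.mul_apply, Matrix.one_apply]
  simp only [monomialMatrix, Matrix.star_apply, Matrix.of_apply, ite_mul, zero_mul,
    Finset.sum_ite_eq', Finset.mem_univ, if_true, EmbeddingLike.apply_eq_iff_eq]
  split_ifs with h
  · rw [← h, hθ]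
  · simp

/-- The Hadamard rotation in the coordinates `k` and `l`. -/
noncomputable def hadamardMatrix (k l : n) : Matrix n n ℂ :=
  Matrix.of fun b x =>
    if b = k then (if x = k then (((Real.sqrt 2)⁻¹ : ℝ) : ℂ) else 0) +
      (if x = l then (((Real.sqrt 2)⁻¹ : ℝ) : ℂ) else 0)
    else if b = l then (if x = k then (((Real.sqrt 2)⁻¹ : ℝ) : ℂ) else 0) -
      (if x = l then (((Real.sqrt 2)⁻¹ : ℝ) : ℂ) else 0)
    else if x = b then 1 else 0

theorem sum_hadamardMatrix_mul (k l b : n) (f : n → ℂ) :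
    ∑ x, hadamardMatrix k l b x * f x =
      if b = k then (((Real.sqrt 2)⁻¹ : ℝ) : ℂ) * (f k + f l)
      else if b = l then (((Real.sqrt 2)⁻¹ : ℝ) : ℂ) * (f k - f l) else f b := by
  simp only [hadamardMatrix, Matrix.of_apply]
  split_ifs
  · simp only [add_mul, ite_mul, zero_mul, Finset.sum_add_distrib, Finset.sum_ite_eq',
      Finset.mem_univ, if_true]
    ring
  · simp only [sub_mul, ite_mul, zero_mul, Finset.sum_sub_distrib, Finset.sum_ite_eq',
      Finset.mem_univ, if_true]
    ring
  · simp

omit [Fintype n] in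
theorem star_hadamardMatrix (k l b x : n) :
    star (hadamardMatrix k l b x) = hadamardMatrix k l b x := by
  simp only [hadamardMatrix, Matrix.of_apply]
  split_ifs <;> simp

theorem inv_sqrt_two_mul_self :
    (((Real.sqrt 2)⁻¹ : ℝ) : ℂ) * (((Real.sqrt 2)⁻¹ : ℝ) : ℂ) = 1 / 2 := by
  rw [← Complex.ofReal_mul, ← mul_inv, Real.mul_self_sqrt (by norm_num)]
  norm_num

theorem hadamardMatrix_mem {k l : n} (hkl : k ≠ l) :
    hadamardMatrix k l ∈ Matrix.unitaryGroup n ℂ := by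
  rw [Matrix.mem_unitaryGroup_iff]
  ext b c
  rw [Matrix.mul_apply]
  simp only [Matrix.star_apply, star_hadamardMatrix, sum_hadamardMatrix_mul, Matrix.one_apply]
  have hs := inv_sqrt_two_mul_self
  simp only [hadamardMatrix, Matrix.of_apply]
  generalize (((Real.sqrt 2)⁻¹ : ℝ) : ℂ) = s at hs ⊢
  by_cases h1 : b = k <;> by_cases h2 : b = l <;> by_cases h3 : c = k <;> by_cases h4 : c = l <;>
    simp_all <;> grind

variable {N : n → n → n → n → ℂ}

theorem IsConjInvariant.monomial (hN : IsConjInvariant N) (σ : Equiv.Perm n) {θ : n → ℂ}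
    (hθ : ∀ b, θ b * star (θ b) = 1) (b b' a a' : n) :
    N b b' a a' = θ b * θ b' * star (θ a) * star (θ a') * N (σ b) (σ b') (σ a) (σ a') := by
  rw [hN _ (monomialMatrix_mem σ hθ) b b' a a']
  simp only [monomialMatrix, Matrix.of_apply, apply_ite star, star_zero, ite_mul, zero_mul,
    Finset.sum_ite_eq', Finset.mem_univ, if_true]
  ring

theorem IsConjInvariant.perm (hN : IsConjInvariant N) (σ : Equiv.Perm n) (b b' a a' : n) :
    N (σ b) (σ b') (σ a) (σ a') = N b b' a a' := by
  have := hN.monomial σ (θ := fun _ => 1) (by simp) b b' a a'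
  simpa using this.symm

theorem IsConjInvariant.eq_zero (hN : IsConjInvariant N) {b b' a a' : n}
    (h : ¬((b = a ∧ b' = a') ∨ (b = a' ∧ b' = a))) : N b b' a a' = 0 := by
  by_contra h0
  -- The phase `I` at one coordinate counts occurrences of `k` in the row pair against the column
  -- pair. A sign would not suffice: it cannot exclude `N k k l l`.
  have key : ∀ k : n, (if b = k then Complex.I else 1) * (if b' = k then Complex.I else 1) *
      (if a = k then -Complex.I else 1) * (if a' = k then -Complex.I else 1) = 1 := by
    intro k
    have := hN.monomial 1 (θ := fun c => if c = k then Complex.I else 1)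
      (by intro c; by_cases hc : c = k <;> simp [hc]) b b' a a'
    simp only [Equiv.Perm.coe_one, id, apply_ite star, star_one, Complex.star_def,
      Complex.conj_I] at this
    exact (mul_right_cancel₀ h0 ((one_mul _).trans this)).symm
  have n1 : Complex.I ≠ 1 := fun e => by simpa using congrArg Complex.re e
  have n2 : -Complex.I ≠ 1 := fun e => by simpa using congrArg Complex.re e
  have n3 : (-1 : ℂ) ≠ 1 := by norm_num
  have k1 := key b
  have k2 := key b'
  have k3 := key a
  have k4 := key a'
  have i2 := Complex.I_mul_I
  by_cases h1 : b = a <;> by_cases h2 : b = a' <;> by_cases h3 : b' = a <;> by_cases h4 : b' = a' <;>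
    by_cases h5 : b = b' <;> by_cases h6 : a = a' <;> simp_all

omit [Fintype n] in
theorem exists_perm_pair {k₀ l₀ k l : n} (h₀ : k₀ ≠ l₀) (h : k ≠ l) :
    ∃ σ : Equiv.Perm n, σ k₀ = k ∧ σ l₀ = l := by
  refine ⟨Equiv.swap l (Equiv.swap k₀ k l₀) * Equiv.swap k₀ k, ?_, ?_⟩
  · rw [Equiv.Perm.mul_apply, Equiv.swap_apply_left, Equiv.swap_apply_of_ne_of_ne h]
    intro e
    apply h₀
    have := congrArg (Equiv.swap k₀ k) e
    rwa [Equiv.swap_apply_right, Equiv.swap_apply_self] at this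
  · rw [Equiv.Perm.mul_apply, Equiv.swap_apply_right]

/-- Phases and permutations leave the values at `kkkk`, `klkl` and `kllk` unrelated; a genuine
rotation mixing `k` and `l` supplies the one missing linear relation. -/
theorem IsConjInvariant.diag_eq (hN : IsConjInvariant N) {k l : n} (hkl : k ≠ l) :
    N k k k k = N k l k l + N k l l k := by
  have hz : N l l l l = N k k k k := by
    have := hN.perm (Equiv.swap k l) k k k k
    simpa using this
  have hx : N l k l k = N k l k l := by
    have := hN.perm (Equiv.swap k l) k l k l
    simpa using this
  have hy : N l k k l = N k l l k := by
    have := hN.perm (Equiv.swap k l) k l l k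
    simpa using this
  have hlk := hkl.symm
  have h := hN _ (hadamardMatrix_mem hkl) k l k l
  simp only [star_hadamardMatrix, sum_hadamardMatrix_mul, if_true, if_neg hlk] at h
  have hs := inv_sqrt_two_mul_self
  generalize (((Real.sqrt 2)⁻¹ : ℝ) : ℂ) = s at hs h
  have e0 : ∀ {b b' a a' : n}, ¬((b = a ∧ b' = a') ∨ (b = a' ∧ b' = a)) → N b b' a a' = 0 :=
    fun h => hN.eq_zero h
  rw [e0 (b := k) (b' := k) (a := k) (a' := l) (by simp [hkl]),
    e0 (b := k) (b' := k) (a := l) (a' := k) (by simp [hkl]),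
    e0 (b := k) (b' := k) (a := l) (a' := l) (by simp [hkl]),
    e0 (b := k) (b' := l) (a := k) (a' := k) (by simp [hlk]),
    e0 (b := k) (b' := l) (a := l) (a' := l) (by simp [hkl]),
    e0 (b := l) (b' := k) (a := k) (a' := k) (by simp [hlk]),
    e0 (b := l) (b' := k) (a := l) (a' := l) (by simp [hkl]),
    e0 (b := l) (b' := l) (a := k) (a' := k) (by simp [hlk]),
    e0 (b := l) (b' := l) (a := k) (a' := l) (by simp [hlk]),
    e0 (b := l) (b' := l) (a := l) (a' := k) (by simp [hlk]), hz, hx, hy] at h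
  have h' : N k l k l = (s * s) * (s * s) * (2 * N k k k k + 2 * N k l k l - 2 * N k l l k) := by
    linear_combination h
  rw [hs] at h'
  linear_combination (-2) * h'

/-- The commutant of the tensors `W ⊗ W` is spanned by the identity and the swap. -/
theorem IsConjInvariant.exists_eq [Nontrivial n] (hN : IsConjInvariant N) :
    ∃ x y : ℂ, ∀ b b' a a', N b b' a a' =
      (if b = a ∧ b' = a' then x else 0) + if b = a' ∧ b' = a then y else 0 := by
  obtain ⟨k, l, hkl⟩ := exists_pair_ne n
  have hp : ∀ b b' : n, b ≠ b' → N b b' b b' = N k l k l ∧ N b b' b' b = N k l l k := by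
    intro b b' hb
    obtain ⟨σ, rfl, rfl⟩ := exists_perm_pair hkl hb
    exact ⟨hN.perm σ _ _ _ _, hN.perm σ _ _ _ _⟩
  refine ⟨N k l k l, N k l l k, fun b b' a a' => ?_⟩
  by_cases h1 : b = a ∧ b' = a'
  · obtain ⟨rfl, rfl⟩ := h1
    by_cases h2 : b = b'
    · subst h2
      obtain ⟨c, hc⟩ := exists_ne b
      rw [hN.diag_eq hc.symm, (hp b c hc.symm).1, (hp b c hc.symm).2]
      simp
    · simp [h2, (hp b b' h2).1]
  · by_cases h2 : b = a' ∧ b' = a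
    · obtain ⟨rfl, rfl⟩ := h2
      have h3 : b ≠ b' := fun h => h1 ⟨h, h.symm⟩
      simp [h3, (hp b b' h3).2]
    · rw [hN.eq_zero (by tauto), if_neg h1, if_neg h2, add_zero]

end Commutant

/-! ### Second moments of Haar measure and of designs. -/

section Haar

variable {d : ℕ}

instance (d : ℕ) : IsProbabilityMeasure (haar d) :=
  ⟨by
    have := Measure.haarMeasure_self (K₀ := (⊤ : TopologicalSpace.PositiveCompacts (U d)))
    simpa [haar] using this⟩

instance (d : ℕ) : (haar d).IsMulLeftInvariant := by
  unfold haar; infer_instance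

/-- The second moments of the matrix entries. -/
noncomputable def moment (D : Measure (U d)) (j j' i i' b b' a a' : Fin d) : ℂ :=
  ∫ V : U d, V.1 b j * V.1 b' j' * star (V.1 a i) * star (V.1 a' i') ∂D

theorem continuous_entry (a i : Fin d) : Continuous fun V : U d => V.1 a i :=
  (continuous_apply_apply a i).comp continuous_subtype_val

theorem integrable_moment (j j' i i' b b' a a' : Fin d) :
    Integrable (fun V : U d => V.1 b j * V.1 b' j' * star (V.1 a i) * star (V.1 a' i')) (haar d) := by
  refine Continuous.integrable_of_hasCompactSupport ?_ (HasCompactSupport.of_compactSpace _)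
  exact (((continuous_entry b j).mul (continuous_entry b' j')).mul
    (continuous_entry a i).star).mul (continuous_entry a' i').star

/-- Left translation acts on the row indices only, so the column indices are mere parameters. -/
theorem isConjInvariant_moment_haar (j j' i i' : Fin d) :
    IsConjInvariant (moment (haar d) j j' i i') := by
  intro W hW b b' a a'
  have h := (integral_mul_left_eq_self (μ := haar d)
    (fun V : U d => V.1 b j * V.1 b' j' * star (V.1 a i) * star (V.1 a' i')) ⟨W, hW⟩).symm
  unfold moment
  rw [h]
  simp only [Finset.mul_sum, ← integral_const_mul]
  have hi : ∀ x x' y y', Integrable (fun V : U d => W b x * (W b' x' * (star (W a y) *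
      (star (W a' y') * (V.1 x j * V.1 x' j' * star (V.1 y i) * star (V.1 y' i')))))) (haar d) :=
    fun x x' y y' => ((((integrable_moment j j' i i' x x' y y').const_mul _).const_mul _).const_mul
      _).const_mul _
  have e : ∀ V : U d, ((⟨W, hW⟩ : U d) * V).1 b j * ((⟨W, hW⟩ : U d) * V).1 b' j' *
      star (((⟨W, hW⟩ : U d) * V).1 a i) * star (((⟨W, hW⟩ : U d) * V).1 a' i') =
      ∑ x, ∑ x', ∑ y, ∑ y', W b x * (W b' x' * (star (W a y) *
      (star (W a' y') * (V.1 x j * V.1 x' j' * star (V.1 y i) * star (V.1 y' i'))))) := by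
    intro V
    simp only [Submonoid.coe_mul, Matrix.mul_apply, star_sum, star_mul']
    rw [Finset.sum_mul_sum, Finset.sum_mul, Finset.sum_mul]
    refine Finset.sum_congr rfl fun x _ => ?_
    rw [Finset.sum_mul, Finset.sum_mul]
    refine Finset.sum_congr rfl fun x' _ => ?_
    rw [mul_assoc, Finset.sum_mul_sum, Finset.mul_sum]
    refine Finset.sum_congr rfl fun y _ => ?_
    rw [Finset.mul_sum]
    refine Finset.sum_congr rfl fun y' _ => ?_
    ring
  simp only [e]
  rw [integral_finsetSum _ fun x _ => integrable_finsetSum _ fun x' _ =>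
    integrable_finsetSum _ fun y _ => integrable_finsetSum _ fun y' _ => hi x x' y y']
  refine Finset.sum_congr rfl fun x _ => ?_
  rw [integral_finsetSum _ fun x' _ =>
    integrable_finsetSum _ fun y _ => integrable_finsetSum _ fun y' _ => hi x x' y y']
  refine Finset.sum_congr rfl fun x' _ => ?_
  rw [integral_finsetSum _ fun y _ => integrable_finsetSum _ fun y' _ => hi x x' y y']
  refine Finset.sum_congr rfl fun y _ => ?_
  rw [integral_finsetSum _ fun y' _ => hi x x' y y']

theorem sum_entry_mul_star (V : U d) (j i : Fin d) :
    ∑ b, V.1 b j * star (V.1 b i) = if j = i then 1 else 0 := by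
  have h := congrFun (congrFun (Matrix.mem_unitaryGroup_iff'.mp V.2) i) j
  rw [Matrix.mul_apply, Matrix.one_apply] at h
  simp only [Matrix.star_apply] at h
  rw [show (if j = i then (1 : ℂ) else 0) = if i = j then 1 else 0 by simp only [eq_comm], ← h]
  exact Finset.sum_congr rfl fun b _ => mul_comm _ _

/-- The second moments of Haar measure. -/
theorem moment_haar (hd : 2 ≤ d) (j j' i i' b b' a a' : Fin d) :
    moment (haar d) j j' i i' b b' a a' =
      ((if b = a ∧ b' = a' then
        ((d : ℂ) * (if j = i ∧ j' = i' then 1 else 0) - if j = i' ∧ j' = i then 1 else 0) else 0) +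
      (if b = a' ∧ b' = a then
        ((d : ℂ) * (if j = i' ∧ j' = i then 1 else 0) - if j = i ∧ j' = i' then 1 else 0) else 0)) /
      (d * (d ^ 2 - 1)) := by
  have : Nontrivial (Fin d) := Fin.nontrivial_iff_two_le.mpr hd
  obtain ⟨x, y, hxy⟩ := (isConjInvariant_moment_haar j j' i i').exists_eq
  -- Orthonormality of the columns evaluates the two contractions of the row indices. They give a
  -- linear system for `x` and `y` with determinant `d² (d² - 1)`, nonzero because `d ≥ 2`.
  have h1 : ∑ b, ∑ b', moment (haar d) j j' i i' b b' b b' =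
      if j = i ∧ j' = i' then 1 else 0 := by
    unfold moment
    simp only [← integral_finsetSum _ fun b' _ => integrable_moment j j' i i' _ b' _ b']
    rw [← integral_finsetSum _ fun b _ =>
      integrable_finsetSum _ fun b' _ => integrable_moment j j' i i' b b' b b']
    have : ∀ V : U d, ∑ b, ∑ b', V.1 b j * V.1 b' j' * star (V.1 b i) * star (V.1 b' i') =
        if j = i ∧ j' = i' then 1 else 0 := by
      intro V
      calc _ = (∑ b, V.1 b j * star (V.1 b i)) * ∑ b', V.1 b' j' * star (V.1 b' i') := by
            rw [Finset.sum_mul_sum]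
            exact Finset.sum_congr rfl fun b _ => Finset.sum_congr rfl fun b' _ => by ring
        _ = _ := by
            rw [sum_entry_mul_star, sum_entry_mul_star]
            by_cases h1 : j = i <;> by_cases h2 : j' = i' <;> simp [h1, h2]
    simp only [this]
    simp
  have h2 : ∑ b, ∑ b', moment (haar d) j j' i i' b b' b' b =
      if j = i' ∧ j' = i then 1 else 0 := by
    unfold moment
    simp only [← integral_finsetSum _ fun b' _ => integrable_moment j j' i i' _ b' b' _]
    rw [← integral_finsetSum _ fun b _ =>
      integrable_finsetSum _ fun b' _ => integrable_moment j j' i i' b b' b' b]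
    have : ∀ V : U d, ∑ b, ∑ b', V.1 b j * V.1 b' j' * star (V.1 b' i) * star (V.1 b i') =
        if j = i' ∧ j' = i then 1 else 0 := by
      intro V
      calc _ = (∑ b, V.1 b j * star (V.1 b i')) * ∑ b', V.1 b' j' * star (V.1 b' i) := by
            rw [Finset.sum_mul_sum]
            exact Finset.sum_congr rfl fun b _ => Finset.sum_congr rfl fun b' _ => by ring
        _ = _ := by
            rw [sum_entry_mul_star, sum_entry_mul_star]
            by_cases h1 : j = i' <;> by_cases h2 : j' = i <;> simp [h1, h2]
    simp only [this]
    simp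
  have d2 : (d : ℂ) ≠ 0 := by
    have : d ≠ 0 := by omega
    exact_mod_cast this
  have d3 : (d : ℂ) ^ 2 - 1 ≠ 0 := by
    intro h
    have h' : ((d ^ 2 : ℕ) : ℂ) = ((1 : ℕ) : ℂ) := by push_cast; linear_combination h
    have h'' : d ^ 2 = 1 := by exact_mod_cast h'
    nlinarith
  have c1 : (d : ℂ) ^ 2 * x + d * y = if j = i ∧ j' = i' then 1 else 0 := by
    rw [← h1]
    simp only [hxy]
    have : ∀ b b' : Fin d, (b = b' ∧ b' = b) ↔ b = b' := fun b b' => ⟨fun h => h.1, fun h => ⟨h, h.symm⟩⟩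
    simp only [if_true, this, Finset.sum_add_distrib, Finset.sum_ite_eq, Finset.mem_univ,
      Finset.sum_const, Finset.card_univ, Fintype.card_fin, nsmul_eq_mul, and_self]
    ring
  have c2 : (d : ℂ) * x + d ^ 2 * y = if j = i' ∧ j' = i then 1 else 0 := by
    rw [← h2]
    simp only [hxy]
    have : ∀ b b' : Fin d, (b = b' ∧ b' = b) ↔ b = b' := fun b b' => ⟨fun h => h.1, fun h => ⟨h, h.symm⟩⟩
    simp only [if_true, this, Finset.sum_add_distrib, Finset.sum_ite_eq, Finset.mem_univ,
      Finset.sum_const, Finset.card_univ, Fintype.card_fin, nsmul_eq_mul, and_self]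
    ring
  rw [hxy, ← c1, ← c2]
  rw [eq_div_iff (mul_ne_zero d2 d3)]
  split_ifs <;> ring

theorem IsUnitaryDesign.moment_eq {D : Measure (U d)} (hD : IsUnitaryDesign 2 D)
    (j j' i i' b b' a a' : Fin d) :
    moment D j j' i i' b b' a a' = moment (haar d) j j' i i' b b' a a' := by
  have h := hD (![b, b'], ![i, i']) (![j, j'], ![a, a'])
  simpa [kronPow, Fin.prod_univ_two, moment, mul_assoc] using h

end Haar

/-! ### The Frobenius norm. -/

section Frobenius

variable {d : ℕ}

theorem frobNorm_sq (A : Matrix (Fin d × Fin d) (Fin d × Fin d) ℂ) :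
    frobNorm A ^ 2 = ∑ i, ∑ j, Complex.normSq (A i j) := by
  rw [frobNorm, Matrix.frobenius_norm_def, ← Real.sqrt_eq_rpow, Real.sq_sqrt (by positivity)]
  simp [Complex.normSq_eq_norm_sq]

theorem frobNorm_nonneg (A : Matrix (Fin d × Fin d) (Fin d × Fin d) ℂ) : 0 ≤ frobNorm A := by
  rw [frobNorm, Matrix.frobenius_norm_def]
  positivity

theorem frobNorm_sq_of_isHermitian {A : Matrix (Fin d × Fin d) (Fin d × Fin d) ℂ}
    (hA : A.IsHermitian) : frobNorm A ^ 2 = (A * A).trace.re := by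
  rw [frobNorm_sq, Matrix.trace, Complex.re_sum]
  refine Finset.sum_congr rfl fun i _ => ?_
  rw [Matrix.diag_apply, Matrix.mul_apply, Complex.re_sum]
  refine Finset.sum_congr rfl fun j _ => ?_
  rw [← hA.apply j i, Complex.star_def, Complex.mul_conj, Complex.ofReal_re]

theorem frobNorm_real_smul (c : ℝ) (A : Matrix (Fin d × Fin d) (Fin d × Fin d) ℂ) :
    frobNorm ((c : ℂ) • A) = |c| * frobNorm A := by
  rw [← abs_of_nonneg (frobNorm_nonneg ((c : ℂ) • A)), ← abs_of_nonneg (frobNorm_nonneg A),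
    ← abs_mul, ← sq_eq_sq_iff_abs_eq_abs, mul_pow, frobNorm_sq, frobNorm_sq, Finset.mul_sum]
  refine Finset.sum_congr rfl fun i _ => ?_
  rw [Finset.mul_sum]
  refine Finset.sum_congr rfl fun j _ => ?_
  rw [Matrix.smul_apply, smul_eq_mul, Complex.normSq_mul, Complex.normSq_ofReal, pow_two]

end Frobenius

/-! ### The rank-one measurement matrices. -/

section MeasurementMatrix

variable {d : ℕ}

/-- The matrix `vec(√d V) vec(√d V)†`. -/
noncomputable def measMat (V : U d) : Matrix (Fin d × Fin d) (Fin d × Fin d) ℂ :=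
  (d : ℂ) • lift V.1

theorem lift_isHermitian (A : Matrix (Fin d) (Fin d) ℂ) : (lift A).IsHermitian := by
  rw [Matrix.IsHermitian, lift, Matrix.conjTranspose_vecMulVec, star_star]

theorem measMat_isHermitian (V : U d) : (measMat V).IsHermitian := by
  rw [Matrix.IsHermitian, measMat, Matrix.conjTranspose_smul, (lift_isHermitian _).eq]
  simp

theorem star_vec_dotProduct_vec (V : U d) : star (vec V.1) ⬝ᵥ vec V.1 = d := by
  rw [dotProduct, Fintype.sum_prod_type_right]
  have h : ∀ j, ∑ b, star (vec V.1) (b, j) * vec V.1 (b, j) = 1 := by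
    intro j
    have := sum_entry_mul_star V j j
    rw [if_pos rfl] at this
    rw [← this]
    exact Finset.sum_congr rfl fun b _ => mul_comm _ _
  simp only [Pi.star_apply] at h ⊢
  simp only [h, Finset.sum_const, Finset.card_univ, Fintype.card_fin, nsmul_eq_mul, mul_one]

theorem lift_sq (V : U d) : lift V.1 ^ 2 = (d : ℂ) • lift V.1 := by
  rw [pow_two, lift, Matrix.vecMulVec_mul_vecMulVec, star_vec_dotProduct_vec]
  rw [Matrix.vecMulVec_smul]

/-- The hypothesis `A a ^ 2 = L • A a` of the moment recursion, with `L = d ^ 2`. -/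
theorem measMat_sq (V : U d) : measMat V ^ 2 = (((d : ℝ) ^ 2 : ℝ) : ℂ) • measMat V := by
  rw [measMat, smul_pow, lift_sq, smul_smul, smul_smul]
  push_cast
  rfl

theorem trace_mul_lift (Z : Matrix (Fin d × Fin d) (Fin d × Fin d) ℂ)
    (A : Matrix (Fin d) (Fin d) ℂ) :
    (Z * lift A).trace = star (vec A) ⬝ᵥ (Z *ᵥ vec A) := by
  rw [lift, Matrix.mul_vecMulVec, Matrix.trace_vecMulVec, dotProduct_comm]

theorem quadForm_eq_trace (Z : Matrix (Fin d × Fin d) (Fin d × Fin d) ℂ)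
    (A : Matrix (Fin d) (Fin d) ℂ) : quadForm Z A = (Z * lift A).trace.re := by
  rw [trace_mul_lift, quadForm]

theorem lift_smul (c : ℂ) (A : Matrix (Fin d) (Fin d) ℂ) :
    lift (c • A) = (c * star c) • lift A := by
  ext p q
  simp [lift, vec, Matrix.vecMulVec_apply]
  ring

theorem trace_mul_measMat_eq (Z : Matrix (Fin d × Fin d) (Fin d × Fin d) ℂ) (V : U d) :
    (Z * measMat V).trace.re = d * quadForm Z V.1 := by
  rw [measMat, mul_smul_comm, Matrix.trace_smul, smul_eq_mul, quadForm_eq_trace,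
    ← Complex.ofReal_natCast, Complex.re_ofReal_mul]

theorem measOp_apply {m : ℕ} (C : Fin m → U d) (Z : Matrix (Fin d × Fin d) (Fin d × Fin d) ℂ)
    (i : Fin m) : measOp C Z i = (Z * measMat (C i)).trace.re := by
  change quadForm Z (((Real.sqrt d : ℝ) : ℂ) • ((C i : U d) : Matrix (Fin d) (Fin d) ℂ)) = _
  rw [quadForm_eq_trace, lift_smul, measMat]
  congr 5
  rw [Complex.star_def, Complex.conj_ofReal, ← Complex.ofReal_mul,
    Real.mul_self_sqrt (Nat.cast_nonneg _), Complex.ofReal_natCast]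

theorem trace_mul_im_eq_zero {n : Type*} [Fintype n] {Z L : Matrix n n ℂ} (hZ : Z.IsHermitian)
    (hL : L.IsHermitian) : (Z * L).trace.im = 0 := by
  have h : star (Z * L).trace = (Z * L).trace := by
    rw [← Matrix.trace_conjTranspose, Matrix.conjTranspose_mul, hZ.eq, hL.eq, Matrix.trace_mul_comm]
  exact Complex.conj_eq_iff_im.mp h

end MeasurementMatrix

/-! ### Mean and mean square of the measurements for a 2-design. -/

section Design

variable {d : ℕ} {G : Finset (U d)} {D : Measure (U d)}

/-- The probability weights on `G` of a measure carried by `G`. -/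
noncomputable def weight (D : Measure (U d)) (G : Finset (U d)) (g : G) : ℝ := D.real {g.1}

theorem integral_eq_sum_weight [IsProbabilityMeasure D] (hG : D ((G : Set (U d))ᶜ) = 0)
    (f : U d → ℂ) : ∫ V, f V ∂D = ∑ g : G, (weight D G g : ℂ) * f g.1 := by
  have h1 : D.restrict (G : Set (U d)) = D := Measure.restrict_eq_self_of_ae_mem hG
  calc ∫ V, f V ∂D = ∫ V in (G : Set (U d)), f V ∂D := by rw [h1]
    _ = ∑ V ∈ G, D.real {V} • f V := setIntegral_finset _ IntegrableOn.finset
    _ = ∑ V ∈ G, (D.real {V} : ℂ) * f V := Finset.sum_congr rfl fun V _ => Complex.real_smul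
    _ = _ := (Finset.sum_coe_sort G (fun V => ((D.real {V} : ℝ) : ℂ) * f V)).symm

theorem isWeight_weight [IsProbabilityMeasure D] (hG : D ((G : Set (U d))ᶜ) = 0) :
    IsWeight (weight D G) := by
  refine ⟨fun _ => measureReal_nonneg, ?_⟩
  have h := integral_eq_sum_weight hG fun _ => 1
  simp only [integral_const, probReal_univ, one_smul, mul_one] at h
  exact_mod_cast h.symm

theorem sum_weight_mul_moment [IsProbabilityMeasure D] (hG : D ((G : Set (U d))ᶜ) = 0)
    (j j' i i' b b' a a' : Fin d) :
    ∑ g : G, (weight D G g : ℂ) *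
      (g.1.1 b j * g.1.1 b' j' * star (g.1.1 a i) * star (g.1.1 a' i')) =
      moment D j j' i i' b b' a a' :=
  (integral_eq_sum_weight hG
    fun V => V.1 b j * V.1 b' j' * star (V.1 a i) * star (V.1 a' i')).symm

theorem sum_weight_smul_measMat [IsProbabilityMeasure D] (hG : D ((G : Set (U d))ᶜ) = 0)
    (hD : IsUnitaryDesign 2 D) (hd : 2 ≤ d) :
    ∑ g : G, (weight D G g : ℂ) • measMat g.1 = 1 := by
  ext ⟨b, j⟩ ⟨a, i⟩
  have d2 : (d : ℂ) ≠ 0 := by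
    have : d ≠ 0 := by omega
    exact_mod_cast this
  have d3 : (d : ℂ) ^ 2 - 1 ≠ 0 := by
    intro h
    have h' : ((d ^ 2 : ℕ) : ℂ) = ((1 : ℕ) : ℂ) := by push_cast; linear_combination h
    have h'' : d ^ 2 = 1 := by exact_mod_cast h'
    nlinarith
  -- Contracting one pair of entries by unitarity extracts first moments from second moments: a
  -- 2-design is a 1-design.
  have h1 : ∑ b', moment D j j i j b b' a b' =
      ∑ g : G, (weight D G g : ℂ) * (g.1.1 b j * star (g.1.1 a i)) := by
    simp only [← sum_weight_mul_moment hG]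
    rw [Finset.sum_comm]
    refine Finset.sum_congr rfl fun g _ => ?_
    rw [← Finset.mul_sum]
    congr 1
    calc _ = g.1.1 b j * star (g.1.1 a i) * ∑ b', g.1.1 b' j * star (g.1.1 b' j) := by
          rw [Finset.mul_sum]
          exact Finset.sum_congr rfl fun b' _ => by ring
      _ = _ := by rw [sum_entry_mul_star, if_pos rfl, mul_one]
  have h2 : ∑ b', moment D j j i j b b' a b' =
      if (b, j) = (a, i) then (d : ℂ)⁻¹ else 0 := by
    simp only [hD.moment_eq, moment_haar hd, and_true, true_and]
    rw [← Finset.sum_div, Finset.sum_add_distrib]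
    have e : ∀ b' : Fin d, (b = b' ∧ b' = a) ↔ (b' = a ∧ b = a) := by grind
    simp only [e, ite_and, Finset.sum_ite_eq', Finset.mem_univ, if_true, Prod.mk.injEq,
      Finset.sum_const, Finset.card_univ, Fintype.card_fin, nsmul_eq_mul]
    rw [div_eq_iff (mul_ne_zero d2 d3)]
    split_ifs <;> field_simp <;> ring
  rw [Matrix.sum_apply, Matrix.one_apply]
  have h3 : ∀ g : G, ((weight D G g : ℂ) • measMat g.1) (b, j) (a, i) =
      d * ((weight D G g : ℂ) * (g.1.1 b j * star (g.1.1 a i))) := by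
    intro g
    simp only [measMat, lift, Matrix.smul_apply, Matrix.vecMulVec_apply, vec, smul_eq_mul,
      Pi.star_apply]
    ring
  simp only [h3]
  rw [← Finset.mul_sum, ← h1, h2]
  split_ifs
  · field_simp
  · simp

variable {Z : Matrix (Fin d × Fin d) (Fin d × Fin d) ℂ}

theorem trace_mul_lift_sq (Z : Matrix (Fin d × Fin d) (Fin d × Fin d) ℂ)
    (A : Matrix (Fin d) (Fin d) ℂ) : (Z * lift A).trace ^ 2 =
      ∑ p, ∑ q, ∑ p', ∑ q', Z p q * Z p' q' *
        (A q.1 q.2 * A q'.1 q'.2 * star (A p.1 p.2) * star (A p'.1 p'.2)) := by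
  have h : (Z * lift A).trace = ∑ p, ∑ q, Z p q * (A q.1 q.2 * star (A p.1 p.2)) := rfl
  rw [pow_two, h, Finset.sum_mul]
  refine Finset.sum_congr rfl fun p _ => ?_
  rw [Finset.sum_mul]
  refine Finset.sum_congr rfl fun q _ => ?_
  rw [Finset.mul_sum]
  refine Finset.sum_congr rfl fun p' _ => ?_
  rw [Finset.mul_sum]
  exact Finset.sum_congr rfl fun q' _ => by ring

/-- The four index patterns in `moment_haar` contract two copies of `Z` to the squared trace, the
trace of the square and the two partial-trace terms. -/
theorem sum_weight_mul_trace_sq [IsProbabilityMeasure D] (hG : D ((G : Set (U d))ᶜ) = 0)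
    (hD : IsUnitaryDesign 2 D) (hd : 2 ≤ d)
    (Z : Matrix (Fin d × Fin d) (Fin d × Fin d) ℂ) :
    ∑ g : G, (weight D G g : ℂ) * (Z * lift g.1.1).trace ^ 2 =
      (d * Z.trace ^ 2 - (ptrace₁ Z * ptrace₁ Z).trace + (d * (Z * Z).trace -
        (ptrace₂ Z * ptrace₂ Z).trace)) / (d * (d ^ 2 - 1)) := by
  simp only [trace_mul_lift_sq, Finset.mul_sum]
  rw [Finset.sum_comm]
  have h1 : ∀ p q p' q' : Fin d × Fin d, ∑ g : G, (weight D G g : ℂ) * (Z p q * Z p' q' *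
      (g.1.1 q.1 q.2 * g.1.1 q'.1 q'.2 * star (g.1.1 p.1 p.2) * star (g.1.1 p'.1 p'.2))) =
      Z p q * Z p' q' * ((if q.1 = p.1 ∧ q'.1 = p'.1 then
        ((d : ℂ) * (if q.2 = p.2 ∧ q'.2 = p'.2 then 1 else 0) -
          if q.2 = p'.2 ∧ q'.2 = p.2 then 1 else 0) else 0) +
      (if q.1 = p'.1 ∧ q'.1 = p.1 then
        ((d : ℂ) * (if q.2 = p'.2 ∧ q'.2 = p.2 then 1 else 0) -
          if q.2 = p.2 ∧ q'.2 = p'.2 then 1 else 0) else 0)) / (d * (d ^ 2 - 1)) := by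
    intro p q p' q'
    rw [mul_div_assoc, ← moment_haar hd, ← hD.moment_eq, ← sum_weight_mul_moment hG,
      Finset.mul_sum]
    exact Finset.sum_congr rfl fun g _ => by ring
  have h2 : ∑ p, ∑ g : G, ∑ q, ∑ p', ∑ q', (weight D G g : ℂ) * (Z p q * Z p' q' *
      (g.1.1 q.1 q.2 * g.1.1 q'.1 q'.2 * star (g.1.1 p.1 p.2) * star (g.1.1 p'.1 p'.2))) =
      ∑ p, ∑ q, ∑ p', ∑ q', ∑ g : G, (weight D G g : ℂ) * (Z p q * Z p' q' *
      (g.1.1 q.1 q.2 * g.1.1 q'.1 q'.2 * star (g.1.1 p.1 p.2) * star (g.1.1 p'.1 p'.2))) := by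
    refine Finset.sum_congr rfl fun p _ => ?_
    rw [Finset.sum_comm]
    refine Finset.sum_congr rfl fun q _ => ?_
    rw [Finset.sum_comm]
    refine Finset.sum_congr rfl fun p' _ => ?_
    rw [Finset.sum_comm]
  rw [h2]
  simp only [h1, ← Finset.sum_div]
  congr 1
  have t1 : Z.trace ^ 2 = ∑ p, ∑ q, ∑ p', ∑ q', Z p q * Z p' q' *
      (if q = p then 1 else 0) * (if q' = p' then 1 else 0) := by
    simp only [mul_ite, mul_one, mul_zero, Finset.sum_ite_eq', Finset.mem_univ, if_true]
    simp only [Finset.sum_ite_irrel, Finset.sum_const_zero, Finset.sum_ite_eq', Finset.mem_univ,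
      if_true]
    rw [pow_two, Matrix.trace, Finset.sum_mul_sum]
    rfl
  have t3 : (Z * Z).trace = ∑ p, ∑ q, ∑ p', ∑ q', Z p q * Z p' q' *
      (if q = p' then 1 else 0) * (if q' = p then 1 else 0) := by
    simp only [mul_ite, mul_one, mul_zero, Finset.sum_ite_eq', Finset.sum_ite_eq, Finset.mem_univ,
      if_true]
    rfl
  have t2 : (ptrace₁ Z * ptrace₁ Z).trace = ∑ p : Fin d × Fin d, ∑ q : Fin d × Fin d,
      ∑ p' : Fin d × Fin d, ∑ q' : Fin d × Fin d, Z p q * Z p' q' *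
      (if q.1 = p.1 then 1 else 0) * (if q'.1 = p'.1 then 1 else 0) *
      (if q.2 = p'.2 then 1 else 0) * (if q'.2 = p.2 then 1 else 0) := by
    simp only [Fintype.sum_prod_type, mul_ite, mul_one, mul_zero,
      Finset.sum_ite_irrel, Finset.sum_const_zero, Finset.sum_ite_eq', Finset.sum_ite_eq,
      Finset.mem_univ, if_true]
    rw [Finset.sum_comm]
    refine Finset.sum_congr rfl fun i _ => ?_
    rw [Matrix.diag_apply, Matrix.mul_apply, Finset.sum_comm]
    refine Finset.sum_congr rfl fun j _ => ?_
    rw [ptrace₁, Matrix.of_apply, Matrix.of_apply, Finset.sum_mul_sum]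
  have t4 : (ptrace₂ Z * ptrace₂ Z).trace = ∑ p : Fin d × Fin d, ∑ q : Fin d × Fin d,
      ∑ p' : Fin d × Fin d, ∑ q' : Fin d × Fin d, Z p q * Z p' q' *
      (if q.1 = p'.1 then 1 else 0) * (if q'.1 = p.1 then 1 else 0) *
      (if q.2 = p.2 then 1 else 0) * (if q'.2 = p'.2 then 1 else 0) := by
    simp only [Fintype.sum_prod_type, mul_ite, mul_one, mul_zero,
      Finset.sum_ite_irrel, Finset.sum_const_zero, Finset.sum_ite_eq', Finset.sum_ite_eq,
      Finset.mem_univ, if_true]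
    refine Finset.sum_congr rfl fun a _ => ?_
    rw [Matrix.diag_apply, Matrix.mul_apply, Finset.sum_comm]
    refine Finset.sum_congr rfl fun b _ => ?_
    rw [ptrace₂, Matrix.of_apply, Matrix.of_apply, Finset.sum_mul_sum]
  rw [t1, t2, t3, t4]
  simp only [Finset.mul_sum, ← Finset.sum_sub_distrib, ← Finset.sum_add_distrib]
  refine Finset.sum_congr rfl fun p _ => Finset.sum_congr rfl fun q _ =>
    Finset.sum_congr rfl fun p' _ => Finset.sum_congr rfl fun q' _ => ?_
  simp only [Prod.ext_iff, ite_and]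
  split_ifs <;> ring

theorem trace_smul_one_mul_self (hd : 2 ≤ d) (t : ℂ) :
    (((t / (d : ℂ)) • (1 : Matrix (Fin d) (Fin d) ℂ)) * ((t / (d : ℂ)) • 1)).trace = t ^ 2 / d := by
  have d2 : (d : ℂ) ≠ 0 := by
    have : d ≠ 0 := by omega
    exact_mod_cast this
  rw [smul_mul_assoc, one_mul, smul_smul, Matrix.trace_smul, Matrix.trace_one, Fintype.card_fin,
    smul_eq_mul]
  field_simp

/-- On matrices with scalar partial traces, the measurement of a design is bounded below in mean
square by the Frobenius norm. -/
theorem frobNorm_sq_le_sum_weight_mul [IsProbabilityMeasure D] (hG : D ((G : Set (U d))ᶜ) = 0)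
    (hD : IsUnitaryDesign 2 D) (hd : 2 ≤ d) (hZ : Z.IsHermitian)
    (h1 : ptrace₁ Z = (Z.trace / (d : ℂ)) • (1 : Matrix (Fin d) (Fin d) ℂ))
    (h2 : ptrace₂ Z = (Z.trace / (d : ℂ)) • (1 : Matrix (Fin d) (Fin d) ℂ)) :
    frobNorm Z ^ 2 ≤ ∑ g : G, weight D G g * (Z * measMat g.1).trace.re ^ 2 := by
  have hd2 : (2 : ℝ) ≤ d := by exact_mod_cast hd
  have h := sum_weight_mul_trace_sq hG hD hd Z
  rw [h1, h2, trace_smul_one_mul_self hd] at h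
  have e1 : ∀ g : G, (Z * lift g.1.1).trace = ((quadForm Z g.1.1 : ℝ) : ℂ) := fun g => by
    rw [quadForm_eq_trace]
    exact Complex.ext rfl (trace_mul_im_eq_zero hZ (lift_isHermitian _))
  have e2 : (Z * Z).trace = ((frobNorm Z ^ 2 : ℝ) : ℂ) := by
    rw [frobNorm_sq_of_isHermitian hZ]
    exact Complex.ext rfl (trace_mul_im_eq_zero hZ hZ)
  have e3 : Z.trace = ((Z.trace.re : ℝ) : ℂ) := by
    have := trace_mul_im_eq_zero hZ Matrix.isHermitian_one
    rw [mul_one] at this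
    exact Complex.ext rfl this
  rw [e3] at h
  simp only [e1, e2] at h
  have h' : ∑ g : G, weight D G g * quadForm Z g.1.1 ^ 2 =
      (d * Z.trace.re ^ 2 - Z.trace.re ^ 2 / d + (d * frobNorm Z ^ 2 - Z.trace.re ^ 2 / d)) /
        (d * (d ^ 2 - 1)) := by exact_mod_cast h
  have h3 : ∑ g : G, weight D G g * (Z * measMat g.1).trace.re ^ 2 =
      d ^ 2 * ∑ g : G, weight D G g * quadForm Z g.1.1 ^ 2 := by
    rw [Finset.mul_sum]
    exact Finset.sum_congr rfl fun g _ => by rw [trace_mul_measMat_eq]; ring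
  have hpos : (0 : ℝ) < d ^ 2 - 1 := by nlinarith
  -- Scalar partial traces turn both negative terms into `(tr Z)² / d`, so the coefficient of `(tr
  -- Z)²` becomes `d ^ 2 - 2 ≥ 0` and the term can be dropped.
  have h4 : (d : ℝ) ^ 2 * ((d * Z.trace.re ^ 2 - Z.trace.re ^ 2 / d +
      (d * frobNorm Z ^ 2 - Z.trace.re ^ 2 / d)) / (d * (d ^ 2 - 1))) =
      ((d ^ 2 - 2) * Z.trace.re ^ 2 + d ^ 2 * frobNorm Z ^ 2) / (d ^ 2 - 1) := by
    field_simp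
    ring
  rw [h3, h', h4, le_div_iff₀ hpos]
  nlinarith [mul_nonneg (by nlinarith : (0 : ℝ) ≤ d ^ 2 - 2) (sq_nonneg Z.trace.re),
    sq_nonneg (frobNorm Z)]

/-- The moment formula divides by `d ^ 2 - 1`, so dimension one is separate; the measurements are
then deterministic. -/
theorem measMat_eq_one_of_dim_one (V : U 1) : measMat V = 1 := by
  ext p q
  have hp : p = (0, 0) := Subsingleton.elim _ _
  have hq : q = (0, 0) := Subsingleton.elim _ _
  subst hp hq
  have := sum_entry_mul_star V 0 0
  simpa [measMat, lift, vec, Matrix.vecMulVec_apply] using this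

theorem trace_mul_measMat_sq_of_dim_one {Z : Matrix (Fin 1 × Fin 1) (Fin 1 × Fin 1) ℂ}
    (hZ : Z.IsHermitian) (V : U 1) : (Z * measMat V).trace.re ^ 2 = frobNorm Z ^ 2 := by
  have h := trace_mul_im_eq_zero hZ Matrix.isHermitian_one
  rw [measMat_eq_one_of_dim_one, frobNorm_sq]
  simp [Matrix.trace, Fintype.sum_prod_type, Complex.normSq_apply] at h ⊢
  rw [h]
  ring

end Design

/-! ### Trace norm of a matrix with one negative direction. -/

section NegativeEigenvalue

variable {n : Type*} [Fintype n] [DecidableEq n] {Z : Matrix n n ℂ}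

theorem star_eigenvectorBasis_dotProduct (hZ : Z.IsHermitian) (i j : n) :
    star ⇑(hZ.eigenvectorBasis i) ⬝ᵥ ⇑(hZ.eigenvectorBasis j) = if i = j then 1 else 0 := by
  have h : star (hZ.eigenvectorUnitary : Matrix n n ℂ) * (hZ.eigenvectorUnitary : Matrix n n ℂ) = 1 :=
    Unitary.coe_star_mul_self _
  have h2 := congrFun (congrFun h i) j
  rw [Matrix.one_apply] at h2
  rw [← h2]
  rfl

omit [DecidableEq n] in
theorem star_dotProduct_vecMulVec_mulVec (v x : n → ℂ) :
    star x ⬝ᵥ (Matrix.vecMulVec v (star v) *ᵥ x) = (star x ⬝ᵥ v) * (star v ⬝ᵥ x) := by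
  rw [Matrix.vecMulVec_mulVec, dotProduct_smul]
  simp

/-- Two negative eigenvectors would span a plane containing a nonzero vector orthogonal to `v`,
where the rank-one term vanishes and positivity fails. -/
theorem not_two_eigenvalues_neg (hZ : Z.IsHermitian) {v : n → ℂ}
    (hv : (Z + Matrix.vecMulVec v (star v)).PosSemidef) {i j : n} (hij : i ≠ j)
    (hi : hZ.eigenvalues i < 0) (hj : hZ.eigenvalues j < 0) : False := by
  set e : n → n → ℂ := fun k => ⇑(hZ.eigenvectorBasis k) with he
  have main : ∀ α β : ℂ, (α ≠ 0 ∨ β ≠ 0) → α * (star v ⬝ᵥ e i) + β * (star v ⬝ᵥ e j) = 0 →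
      False := by
    intro α β hαβ h0
    set x : n → ℂ := α • e i + β • e j with hx
    have hvx : star v ⬝ᵥ x = 0 := by
      rw [hx, dotProduct_add, dotProduct_smul, dotProduct_smul]
      exact h0
    have hp := hv.dotProduct_mulVec_nonneg x
    rw [Matrix.add_mulVec, dotProduct_add, star_dotProduct_vecMulVec_mulVec, hvx, mul_zero,
      add_zero] at hp
    have hZx : Z *ᵥ x = (α * hZ.eigenvalues i) • e i + (β * hZ.eigenvalues j) • e j := by
      rw [hx, Matrix.mulVec_add, Matrix.mulVec_smul, Matrix.mulVec_smul,
        hZ.mulVec_eigenvectorBasis i, hZ.mulVec_eigenvectorBasis j, mul_smul, mul_smul]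
      rfl
    have hval : star x ⬝ᵥ (Z *ᵥ x) =
        ((Complex.normSq α * hZ.eigenvalues i + Complex.normSq β * hZ.eigenvalues j : ℝ) : ℂ) := by
      rw [hZx, hx]
      simp only [star_add, star_smul, add_dotProduct, dotProduct_add, smul_dotProduct,
        dotProduct_smul, he, star_eigenvectorBasis_dotProduct, if_neg hij, if_neg hij.symm, if_true,
        smul_eq_mul, mul_one, mul_zero, add_zero, zero_add]
      push_cast
      rw [← Complex.mul_conj, ← Complex.mul_conj, Complex.star_def]
      ring
    rw [hval] at hp
    have hp' : 0 ≤ Complex.normSq α * hZ.eigenvalues i + Complex.normSq β * hZ.eigenvalues j := by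
      exact_mod_cast hp
    rcases hαβ with h | h
    · have := Complex.normSq_pos.mpr h
      nlinarith [Complex.normSq_nonneg β]
    · have := Complex.normSq_pos.mpr h
      nlinarith [Complex.normSq_nonneg α]
  by_cases h : star v ⬝ᵥ e i = 0 ∧ star v ⬝ᵥ e j = 0
  · exact main 1 0 (Or.inl one_ne_zero) (by rw [h.1, h.2]; ring)
  · refine main (star v ⬝ᵥ e j) (-(star v ⬝ᵥ e i)) ?_ (by ring)
    rw [neg_ne_zero]
    tauto

/-- The trace norm of a matrix with nonpositive trace and at most one negative direction. -/
theorem sum_abs_eigenvalues_le (hZ : Z.IsHermitian) {v : n → ℂ}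
    (hv : (Z + Matrix.vecMulVec v (star v)).PosSemidef) (htr : Z.trace.re ≤ 0) {f : ℝ}
    (hf : 0 ≤ f) (hf2 : (Z * Z).trace.re = f ^ 2) : ∑ i, |hZ.eigenvalues i| ≤ 2 * f := by
  have h1 : ∑ i, hZ.eigenvalues i ≤ 0 := by
    have := trace_pow_eq_sum hZ 1
    simp only [pow_one] at this
    rw [← this]
    exact htr
  have h2 : ∑ i, hZ.eigenvalues i ^ 2 = f ^ 2 := by
    rw [← trace_pow_eq_sum hZ 2, pow_two, hf2]
  have h3 : ∀ i, |hZ.eigenvalues i| ≤ f := by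
    intro i
    refine abs_le_of_sq_le_sq ?_ hf
    rw [← h2]
    exact Finset.single_le_sum (f := fun i => hZ.eigenvalues i ^ 2) (fun i _ => sq_nonneg _)
      (Finset.mem_univ i)
  -- As the trace is nonpositive, the positive eigenvalues sum to at most the modulus of the single
  -- negative one, which is at most `f`.
  by_cases h : ∃ i, hZ.eigenvalues i < 0
  · obtain ⟨i, hi⟩ := h
    have h4 : ∑ j, (|hZ.eigenvalues j| - hZ.eigenvalues j) =
        |hZ.eigenvalues i| - hZ.eigenvalues i := by
      refine Finset.sum_eq_single i (fun j _ hj => ?_) fun h => absurd (Finset.mem_univ i) h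
      have : 0 ≤ hZ.eigenvalues j := by
        by_contra hneg
        exact not_two_eigenvalues_neg hZ hv hj (not_le.mp hneg) hi
      rw [abs_of_nonneg this, sub_self]
    rw [Finset.sum_sub_distrib] at h4
    have h5 := h3 i
    rw [abs_of_neg hi] at h4 h5
    linarith
  · push Not at h
    have : ∑ i, |hZ.eigenvalues i| = ∑ i, hZ.eigenvalues i :=
      Finset.sum_congr rfl fun i _ => abs_of_nonneg (h i)
    linarith

end NegativeEigenvalue

/-! ### Test matrices and their Rademacher complexity. -/

section TestMatrices

variable {d : ℕ} {G : Finset (U d)} {ν : ℝ}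

/-- The normalized differences between a solution of the program and the matrix to recover. -/
structure IsTestMatrix (G : Finset (U d)) (ν : ℝ)
    (Z : Matrix (Fin d × Fin d) (Fin d × Fin d) ℂ) : Prop where
  isHermitian : Z.IsHermitian
  frobNorm_eq : frobNorm Z = 1
  ptrace₁_eq : ptrace₁ Z = (Z.trace / (d : ℂ)) • (1 : Matrix (Fin d) (Fin d) ℂ)
  ptrace₂_eq : ptrace₂ Z = (Z.trace / (d : ℂ)) • (1 : Matrix (Fin d) (Fin d) ℂ)
  trace_re_nonpos : Z.trace.re ≤ 0
  exists_posSemidef : ∃ v, (Z + Matrix.vecMulVec v (star v)).PosSemidef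
  abs_le : ∀ g ∈ G, |(Z * measMat g).trace.re| ≤ ν

variable {Z : Matrix (Fin d × Fin d) (Fin d × Fin d) ℂ}

theorem IsTestMatrix.sum_abs_eigenvalues_le (hZ : IsTestMatrix G ν Z) :
    ∑ i, |hZ.isHermitian.eigenvalues i| ≤ 2 := by
  obtain ⟨v, hv⟩ := hZ.exists_posSemidef
  have := PhaseLift.sum_abs_eigenvalues_le hZ.isHermitian hv hZ.trace_re_nonpos zero_le_one
    (by rw [← frobNorm_sq_of_isHermitian hZ.isHermitian, hZ.frobNorm_eq])
  linarith

theorem IsTestMatrix.abs_trace_mul_le (hZ : IsTestMatrix G ν Z)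
    {M : Matrix (Fin d × Fin d) (Fin d × Fin d) ℂ} (hM : M.IsHermitian) {s : ℝ} (hs : 0 < s)
    (p : ℕ) : |(Z * M).trace.re| ≤
      2 * (s + (M ^ (2 * (p + 1))).trace.re / s ^ (2 * p + 1)) := by
  have h0 : 0 ≤ s + (M ^ (2 * (p + 1))).trace.re / s ^ (2 * p + 1) :=
    add_nonneg hs.le (div_nonneg (trace_pow_even_nonneg hM _) (by positivity))
  exact (PhaseLift.abs_trace_mul_le hZ.isHermitian hM (abs_eigenvalues_le hM hs p)).trans
    (mul_le_mul_of_nonneg_right hZ.sum_abs_eigenvalues_le h0)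

theorem IsTestMatrix.abs_trace_le (hZ : IsTestMatrix G ν Z) : |Z.trace.re| ≤ 2 := by
  have h := trace_pow_eq_sum hZ.isHermitian 1
  simp only [pow_one] at h
  rw [h]
  exact (Finset.abs_sum_le_sum_abs _ _).trans hZ.sum_abs_eigenvalues_le

/-- A mean square of at least 1 forces the uniform bound `ν` to be at least 1. So small `ν`,
including 0, admits no test matrix at all. -/
theorem IsTestMatrix.one_le (hZ : IsTestMatrix G ν Z) {w : G → ℝ} (hw : IsWeight w)
    (h : 1 ≤ ∑ g : G, w g * (Z * measMat g.1).trace.re ^ 2) : 1 ≤ ν := by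
  have hne : Nonempty G := by
    by_contra hG
    rw [not_nonempty_iff] at hG
    simpa using hw.sum_eq
  obtain ⟨g₀⟩ := hne
  have hν : 0 ≤ ν := (abs_nonneg _).trans (hZ.abs_le g₀.1 g₀.2)
  have h2 : ∑ g : G, w g * (Z * measMat g.1).trace.re ^ 2 ≤ ν ^ 2 := by
    calc _ ≤ ∑ g : G, w g * ν ^ 2 := by
          refine Finset.sum_le_sum fun g _ => mul_le_mul_of_nonneg_left ?_ (hw.nonneg g)
          exact sq_le_sq' (_root_.abs_le.mp (hZ.abs_le g.1 g.2)).1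
            (_root_.abs_le.mp (hZ.abs_le g.1 g.2)).2
      _ = ν ^ 2 := by rw [← Finset.sum_mul, hw.sum_eq, one_mul]
  nlinarith

variable {m : ℕ}

/-- For fixed signs the indices split into two fixed sets, so the moment bound for centred sums
applies to each. Centring leaves only the total sign times `tr Z`. -/
theorem sum_sgn_mul_trace_eq (A : G → Matrix (Fin d × Fin d) (Fin d × Fin d) ℂ)
    (Z : Matrix (Fin d × Fin d) (Fin d × Fin d) ℂ) (b : Fin m → Bool) (C : Fin m → G) :
    ∑ i, sgn (b i) * (Z * A (C i)).trace.re =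
      (Z * centredSum A {i | b i = true} C).trace.re -
        (Z * centredSum A {i | b i = false} C).trace.re + (∑ i, sgn (b i)) * Z.trace.re := by
  have h1 : ∀ P : Finset (Fin m), (Z * centredSum A P C).trace.re =
      ∑ i ∈ P, ((Z * A (C i)).trace.re - Z.trace.re) := by
    intro P
    rw [centredSum, Finset.mul_sum, Matrix.trace_sum, Complex.re_sum]
    exact Finset.sum_congr rfl fun i _ => by rw [mul_sub, mul_one, Matrix.trace_sub, Complex.sub_re]
  rw [h1, h1, Finset.sum_filter, Finset.sum_filter, Finset.sum_mul, ← Finset.sum_sub_distrib,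
    ← Finset.sum_add_distrib]
  refine Finset.sum_congr rfl fun i _ => ?_
  cases b i
  · simp [sgn]
    ring
  · simp [sgn]

/-- The Rademacher complexity of the class of test matrices. -/
theorem rademacher_le [Nonempty {Z // IsTestMatrix G ν Z}] {w : G → ℝ} (hw : IsWeight w)
    (hmean : ∑ g : G, (w g : ℂ) • measMat g.1 = 1) {p : ℕ} {k s : ℝ}
    (hk : 4 * ((p + 1 : ℕ) : ℝ) * (d : ℝ) ^ 2 ≤ k) (hs : 0 < s)
    (hsp : (d : ℝ) ^ 2 * (k ^ 2 + 4 * k * m) ^ (p + 1) ≤ s ^ (2 * (p + 1))) :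
    prodMean w (fun C : Fin m → G => signMean fun b : Fin m → Bool =>
      ⨆ t : {Z // IsTestMatrix G ν Z}, ∑ i, sgn (b i) * (t.1 * measMat (C i).1).trace.re) ≤
      8 * s + 2 * Real.sqrt m := by
  set A : G → Matrix (Fin d × Fin d) (Fin d × Fin d) ℂ := fun g => measMat g.1 with hAdef
  have hA : ∀ g, (A g).IsHermitian := fun g => measMat_isHermitian g.1
  have hX := fun P (C : Fin m → G) => centredSum_isHermitian hA P C
  set B : Finset (Fin m) → (Fin m → G) → ℝ := fun P C =>
    s + (s ^ (2 * p + 1))⁻¹ * (centredSum A P C ^ (2 * (p + 1))).trace.re with hB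
  -- Hypothesis `hsp` balances the two terms of `B`. With trace norm 2 and two index sets this gives
  -- `2 * 2s + 2 * 2s = 8s`.
  have hBmean : ∀ P, prodMean w (B P) ≤ 2 * s := by
    intro P
    rw [hB, prodMean_add, prodMean_const_mul, prodMean_const hw]
    have h1 := prodMean_trace_pow_le (m := m) hw hA (L := (d : ℝ) ^ 2) (by positivity)
      (fun g => measMat_sq g.1) hmean P (p + 1) hk
    rw [Fintype.card_prod, Fintype.card_fin, Nat.cast_mul, ← pow_two] at h1
    have h2 : (s ^ (2 * p + 1))⁻¹ *
        prodMean w (fun C => (centredSum A P C ^ (2 * (p + 1))).trace.re) ≤ s := by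
      rw [inv_mul_le_iff₀ (by positivity)]
      refine (h1.trans hsp).trans_eq ?_
      ring
    linarith
  have hpt : ∀ (C : Fin m → G) (b : Fin m → Bool),
      ⨆ t : {Z // IsTestMatrix G ν Z}, ∑ i, sgn (b i) * (t.1 * measMat (C i).1).trace.re ≤
        2 * B {i | b i = true} C + 2 * B {i | b i = false} C + 2 * |∑ i, sgn (b i)| := by
    intro C b
    refine ciSup_le fun t => ?_
    rw [sum_sgn_mul_trace_eq A]
    have h1 := t.2.abs_trace_mul_le (hX {i | b i = true} C) hs p
    have h2 := t.2.abs_trace_mul_le (hX {i | b i = false} C) hs p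
    have h3 : (∑ i, sgn (b i)) * t.1.trace.re ≤ 2 * |∑ i, sgn (b i)| := by
      refine (le_abs_self _).trans ?_
      rw [abs_mul, mul_comm]
      exact mul_le_mul_of_nonneg_right t.2.abs_trace_le (abs_nonneg _)
    rw [div_eq_inv_mul] at h1 h2
    have h4 := (_root_.abs_le.mp h1).2
    have h5 := (_root_.abs_le.mp h2).1
    simp only [hB]
    linarith
  calc _ ≤ prodMean w (fun C : Fin m → G => signMean fun b : Fin m → Bool =>
        2 * B {i | b i = true} C + 2 * B {i | b i = false} C + 2 * |∑ i, sgn (b i)|) :=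
        prodMean_mono hw fun C => prodMean_mono isWeight_half (hpt C)
    _ = signMean fun b : Fin m → Bool => 2 * prodMean w (B {i | b i = true}) +
          2 * prodMean w (B {i | b i = false}) + 2 * |∑ i, sgn (b i)| := by
        rw [signMean, prodMean_comm]
        congr 1
        funext b
        rw [prodMean_add, prodMean_add, prodMean_const_mul, prodMean_const_mul, prodMean_const hw]
    _ ≤ signMean fun b : Fin m → Bool => 8 * s + 2 * |∑ i, sgn (b i)| :=
        prodMean_mono isWeight_half fun b => by
          linarith [hBmean {i | b i = true}, hBmean {i | b i = false}]
    _ ≤ 8 * s + 2 * Real.sqrt m := by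
        rw [signMean, prodMean_add, prodMean_const isWeight_half, prodMean_const_mul]
        have := signMean_abs_sum_le m
        simp only [signMean] at this
        linarith

theorem exists_moment_order {d : ℕ} (hd : 2 ≤ d) :
    ∃ p : ℕ, Real.log d ≤ ((p + 1 : ℕ) : ℝ) ∧ ((p + 1 : ℕ) : ℝ) ≤ 3 * Real.log d := by
  have hd' : (2 : ℝ) ≤ d := by exact_mod_cast hd
  have hl : 1 / 2 < Real.log d :=
    lt_of_lt_of_le (by linarith [Real.log_two_gt_d9]) (Real.log_le_log (by norm_num) hd')
  have h1 : 0 < ⌈Real.log d⌉₊ := Nat.ceil_pos.mpr (by linarith)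
  refine ⟨⌈Real.log d⌉₊ - 1, ?_, ?_⟩ <;> rw [Nat.sub_add_cancel h1]
  · exact Nat.le_ceil _
  · have := Nat.ceil_lt_add_one (a := Real.log d) (by linarith)
    linarith

/-- A moment order of at least `log d` makes the dimension factor harmless: `d ≤ e ^ p ≤ 3 ^ p`, so
it costs a factor 9 per step. -/
theorem sq_mul_pow_le {d : ℕ} (hd : 2 ≤ d) {p : ℕ} (hp : Real.log d ≤ p) {K s : ℝ} (hK : 0 ≤ K)
    (hs : 9 * K ≤ s ^ 2) : (d : ℝ) ^ 2 * K ^ p ≤ s ^ (2 * p) := by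
  have hd0 : (0 : ℝ) < d := by
    have : 0 < d := by omega
    exact_mod_cast this
  have h1 : (d : ℝ) ≤ 3 ^ p := by
    calc (d : ℝ) = Real.exp (Real.log d) := (Real.exp_log hd0).symm
      _ ≤ Real.exp p := Real.exp_le_exp.mpr hp
      _ = Real.exp 1 ^ p := by rw [← Real.exp_nat_mul, mul_one]
      _ ≤ 3 ^ p := by
          gcongr
          linarith [Real.exp_one_lt_d9]
  calc (d : ℝ) ^ 2 * K ^ p ≤ (3 ^ p) ^ 2 * K ^ p := by gcongr
    _ = (9 * K) ^ p := by rw [← pow_mul, mul_comm p 2, pow_mul, mul_pow]; norm_num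
    _ ≤ (s ^ 2) ^ p := by gcongr
    _ = _ := by rw [← pow_mul]

/-- With high probability the measurement is bounded below on all test matrices. -/
theorem prodMean_exists_testMatrix_le {D : Measure (U d)} [IsProbabilityMeasure D]
    (hG : D ((G : Set (U d))ᶜ) = 0) (hD : IsUnitaryDesign 2 D) (hd : 2 ≤ d)
    [hT : Nonempty {Z // IsTestMatrix G ν Z}] {c₀ : ℝ} (hc₀ : 400 ≤ c₀)
    (hm : (8 * c₀ * ν ^ 2) ^ 2 * ((d : ℝ) ^ 2 * Real.log d) ≤ (m : ℝ)) :
    prodMean (weight D G) (Set.indicator {C : Fin m → G | ∃ t : {Z // IsTestMatrix G ν Z},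
      ∑ i, (t.1 * measMat (C i).1).trace.re ^ 2 < m / 6} 1) ≤ Real.exp (-(m / (8 * ν ^ 4))) := by
  have hw := isWeight_weight hG
  have hq2 : ∀ t : {Z // IsTestMatrix G ν Z},
      1 ≤ ∑ g : G, weight D G g * (t.1 * measMat g.1).trace.re ^ 2 := by
    intro t
    have := frobNorm_sq_le_sum_weight_mul hG hD hd t.2.isHermitian t.2.ptrace₁_eq t.2.ptrace₂_eq
    rwa [t.2.frobNorm_eq, one_pow] at this
  have hν : 1 ≤ ν := by
    obtain ⟨t⟩ := hT
    exact t.2.one_le hw (hq2 t)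
  obtain ⟨p, hp1, hp2⟩ := exists_moment_order hd
  have hd' : (2 : ℝ) ≤ d := by exact_mod_cast hd
  have hl : 1 / 2 < Real.log d :=
    lt_of_lt_of_le (by linarith [Real.log_two_gt_d9]) (Real.log_le_log (by norm_num) hd')
  set E : ℝ := (d : ℝ) ^ 2 * Real.log d with hE
  have hE1 : 1 ≤ E := by nlinarith
  have hc0 : 0 < c₀ := by linarith
  have hν2 : 1 ≤ ν ^ 2 := by nlinarith
  have hν0 : 0 < ν := by linarith
  have hM : 1 ≤ 8 * c₀ * ν ^ 2 := by nlinarith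
  set M : ℝ := 8 * c₀ * ν ^ 2 with hMd
  have hM3200 : 3200 ≤ M := by nlinarith
  have hmM : M ^ 2 ≤ m := by nlinarith
  have hm0 : (0 : ℝ) < m := by nlinarith
  have hmN : 0 < m := by exact_mod_cast hm0
  -- With `k = 12 * E ≤ m`, the moment condition needs `s ^ 2 ≥ 540 * E * m`; since `M ^ 2 * E ≤ m`,
  -- this choice gives `s ^ 2 ≥ 576 * E * m`.
  set s : ℝ := 24 * m / M with hs
  have hs0 : 0 < s := by positivity
  have hk : 4 * ((p + 1 : ℕ) : ℝ) * (d : ℝ) ^ 2 ≤ 12 * E := by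
    rw [hE]; nlinarith [sq_nonneg (d : ℝ)]
  have hkm : 12 * E ≤ m := by
    have h12 : 12 ≤ M ^ 2 := by nlinarith
    linarith [mul_le_mul_of_nonneg_right h12 (by linarith : 0 ≤ E)]
  have hs2 : 9 * ((12 * E) ^ 2 + 4 * (12 * E) * m) ≤ s ^ 2 := by
    have h1 : 9 * ((12 * E) ^ 2 + 4 * (12 * E) * m) ≤ 540 * E * m := by nlinarith
    have h2 : 540 * E * m ≤ s ^ 2 := by
      rw [hs, div_pow, le_div_iff₀ (by positivity)]
      nlinarith
    exact h1.trans h2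
  have hR := rademacher_le (m := m) (ν := ν) hw (sum_weight_smul_measMat hG hD hd) hk hs0
    (sq_mul_pow_le hd hp1 (by positivity) hs2)
  refine prodMean_exists_sum_sq_lt_le hw hmN (q := fun (t : {Z // IsTestMatrix G ν Z}) (g : G) =>
    (t.1 * measMat g.1).trace.re) hν0 (fun t g => t.2.abs_le g.1 g.2) hq2 hR ?_
  have hsq : Real.sqrt m ≤ m / M := by
    rw [Real.sqrt_le_left (by positivity), div_pow, le_div_iff₀ (by positivity), pow_two (m : ℝ)]
    exact mul_le_mul_of_nonneg_left hmM hm0.le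
  have hνM : ν * 3200 ≤ M := by nlinarith
  -- Here `776 = 4 * (8 * 24 + 2)`. As `M ≥ 3200 * ν`, the product is at most `776 / 3200 * m`,
  -- below `m / 3`; this is where `c₀ ≥ 400` matters.
  have h1 : 4 * ν * (8 * s + 2 * Real.sqrt m) ≤ 776 * (ν * (m / M)) := by
    have : s = 24 * (m / M) := by rw [hs]; ring
    rw [this]
    nlinarith
  have h2 : ν * (m / M) ≤ m / 3200 := by
    rw [mul_div_assoc', div_le_div_iff₀ (by positivity) (by norm_num)]
    nlinarith
  linarith

end TestMatrices

/-! ### From solutions of the program to test matrices. -/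

section Program

variable {d m : ℕ} {G : Finset (U d)}

theorem ptrace₁_lift (V : U d) : ptrace₁ (lift V.1) = 1 := by
  ext i j
  rw [ptrace₁, Matrix.of_apply, Matrix.one_apply, ← sum_entry_mul_star V i j]
  rfl

theorem sum_row_mul_star (V : U d) (a b : Fin d) :
    ∑ i, V.1 a i * star (V.1 b i) = if a = b then 1 else 0 := by
  have h := congrFun (congrFun (Matrix.mem_unitaryGroup_iff.mp V.2) a) b
  rw [Matrix.mul_apply, Matrix.one_apply] at h
  exact h

theorem ptrace₂_lift (V : U d) : ptrace₂ (lift V.1) = 1 := by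
  ext a b
  rw [ptrace₂, Matrix.of_apply, Matrix.one_apply, ← sum_row_mul_star V a b]
  rfl

theorem trace_lift (V : U d) : (lift V.1).trace = d := by
  rw [lift, Matrix.trace_vecMulVec, dotProduct_comm, star_vec_dotProduct_vec]

theorem posSemidef_lift (A : Matrix (Fin d) (Fin d) ℂ) : (lift A).PosSemidef :=
  Matrix.posSemidef_vecMulVec_self_star _

theorem frobNorm_lift (V : U d) : frobNorm (lift V.1) = d := by
  have h : frobNorm (lift V.1) ^ 2 = (d : ℝ) ^ 2 := by
    rw [frobNorm_sq_of_isHermitian (lift_isHermitian _), ← pow_two, lift_sq, Matrix.trace_smul,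
      trace_lift, smul_eq_mul, ← Nat.cast_mul, Complex.natCast_re]
    push_cast
    ring
  exact (pow_left_inj₀ (frobNorm_nonneg _) (Nat.cast_nonneg _) two_ne_zero).mp h

theorem quadForm_lift (A B : Matrix (Fin d) (Fin d) ℂ) :
    quadForm (lift A) B = ‖(Bᴴ * A).trace‖ ^ 2 := by
  have h : (Bᴴ * A).trace = star (vec B) ⬝ᵥ vec A := by
    rw [Matrix.trace, dotProduct, Fintype.sum_prod_type_right]
    rfl
  rw [quadForm, lift, star_dotProduct_vecMulVec_mulVec, h, ← Complex.normSq_eq_norm_sq]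
  have h2 : star (vec A) ⬝ᵥ vec B = star (star (vec B) ⬝ᵥ vec A) :=
    Matrix.star_dotProduct _ _
  rw [h2, Complex.star_def, Complex.mul_conj, Complex.ofReal_re]

theorem quadForm_sub (Γ Γ' : Matrix (Fin d × Fin d) (Fin d × Fin d) ℂ)
    (A : Matrix (Fin d) (Fin d) ℂ) : quadForm (Γ - Γ') A = quadForm Γ A - quadForm Γ' A := by
  rw [quadForm_eq_trace, quadForm_eq_trace, quadForm_eq_trace, sub_mul, Matrix.trace_sub,
    Complex.sub_re]

theorem measOp_sub (C : Fin m → U d) (Γ Γ' : Matrix (Fin d × Fin d) (Fin d × Fin d) ℂ) :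
    measOp C (Γ - Γ') = measOp C Γ - measOp C Γ' := by
  ext i
  rw [PiLp.sub_apply, measOp_apply, measOp_apply, measOp_apply, sub_mul, Matrix.trace_sub,
    Complex.sub_re]

theorem ptrace₁_sub (Γ Γ' : Matrix (Fin d × Fin d) (Fin d × Fin d) ℂ) :
    ptrace₁ (Γ - Γ') = ptrace₁ Γ - ptrace₁ Γ' := by
  ext i j
  simp [ptrace₁, Finset.sum_sub_distrib]

theorem ptrace₂_sub (Γ Γ' : Matrix (Fin d × Fin d) (Fin d × Fin d) ℂ) :
    ptrace₂ (Γ - Γ') = ptrace₂ Γ - ptrace₂ Γ' := by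
  ext i j
  simp [ptrace₂, Finset.sum_sub_distrib]

theorem ptrace₁_smul (c : ℂ) (Γ : Matrix (Fin d × Fin d) (Fin d × Fin d) ℂ) :
    ptrace₁ (c • Γ) = c • ptrace₁ Γ := by
  ext i j
  simp [ptrace₁, Finset.mul_sum]

theorem ptrace₂_smul (c : ℂ) (Γ : Matrix (Fin d × Fin d) (Fin d × Fin d) ℂ) :
    ptrace₂ (c • Γ) = c • ptrace₂ Γ := by
  ext i j
  simp [ptrace₂, Finset.mul_sum]

theorem isFeasible_lift (hd : 1 ≤ d) {β : ℝ} {V : U d} (hV : IsNonSpiky G β V)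
    (C : Fin m → U d) {η : ℝ} {ε : EuclideanSpace ℝ (Fin m)} (hε : ‖ε‖ ≤ η) :
    IsFeasible G β C (measOp C (lift V.1) + ε) η (lift V.1) := by
  have d0 : (d : ℂ) ≠ 0 := by
    have : d ≠ 0 := by omega
    exact_mod_cast this
  refine ⟨?_, posSemidef_lift _, ?_, ?_, fun B hB => ?_⟩
  · rwa [sub_add_cancel_left, norm_neg]
  · rw [ptrace₁_lift, trace_lift, div_self d0, one_smul]
  · rw [ptrace₂_lift, trace_lift, div_self d0, one_smul]
  · rw [quadForm_lift]
    exact ⟨by positivity, hV B hB⟩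

/-- A solution far from the matrix to recover gives a test matrix. -/
theorem isTestMatrix_of_isSolution (hd : 1 ≤ d) {β δ : ℝ} (hδ : 0 < δ) {V : U d}
    (hV : IsNonSpiky G β V) {C : Fin m → U d} {η : ℝ} {ε : EuclideanSpace ℝ (Fin m)}
    (hε : ‖ε‖ ≤ η) {Γ : Matrix (Fin d × Fin d) (Fin d × Fin d) ℂ}
    (hΓ : IsSolution G β C (measOp C (lift V.1) + ε) η Γ)
    (hfar : δ * d < frobNorm (Γ - lift V.1)) :
    IsTestMatrix G (β / δ) ((((frobNorm (Γ - lift V.1))⁻¹ : ℝ) : ℂ) • (Γ - lift V.1)) := by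
  have hd0 : (0 : ℝ) < d := by exact_mod_cast hd
  have d0 : (d : ℂ) ≠ 0 := by exact_mod_cast hd0.ne'
  set f := frobNorm (Γ - lift V.1) with hf
  have hf0 : 0 < f := lt_trans (by positivity) hfar
  obtain ⟨hfeas, hmin⟩ := hΓ
  -- This vector restores the subtracted rank-one part: the sum is `f⁻¹ • Γ`, which is positive
  -- semidefinite.
  refine ⟨?_, ?_, ?_, ?_, ?_, ⟨(Real.sqrt f⁻¹ : ℂ) • vec V.1, ?_⟩, fun g hg => ?_⟩
  · rw [Matrix.IsHermitian, Matrix.conjTranspose_smul,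
      (hfeas.posSemidef.isHermitian.sub (lift_isHermitian _)).eq, Complex.star_def,
      Complex.conj_ofReal]
  · rw [frobNorm_real_smul, ← hf, abs_of_pos (by positivity), inv_mul_cancel₀ hf0.ne']
  · rw [ptrace₁_smul, ptrace₁_sub, hfeas.ptrace₁_eq, ptrace₁_lift, Matrix.trace_smul,
      Matrix.trace_sub, trace_lift, smul_eq_mul, mul_div_assoc, sub_div, div_self d0, mul_smul,
      sub_smul, one_smul]
  · rw [ptrace₂_smul, ptrace₂_sub, hfeas.ptrace₂_eq, ptrace₂_lift, Matrix.trace_smul,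
      Matrix.trace_sub, trace_lift, smul_eq_mul, mul_div_assoc, sub_div, div_self d0, mul_smul,
      sub_smul, one_smul]
  · rw [Matrix.trace_smul, smul_eq_mul, Complex.re_ofReal_mul, Matrix.trace_sub, Complex.sub_re]
    refine mul_nonpos_of_nonneg_of_nonpos (by positivity) ?_
    linarith [hmin _ (isFeasible_lift hd hV C hε)]
  · have e : Matrix.vecMulVec ((Real.sqrt f⁻¹ : ℂ) • vec V.1)
        (star ((Real.sqrt f⁻¹ : ℂ) • vec V.1)) = ((f⁻¹ : ℝ) : ℂ) • lift V.1 := by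
      rw [star_smul, Matrix.smul_vecMulVec, Matrix.vecMulVec_smul, smul_smul, Complex.star_def,
        Complex.conj_ofReal, ← Complex.ofReal_mul, Real.mul_self_sqrt (by positivity)]
      rfl
    rw [e, ← smul_add, sub_add_cancel]
    refine hfeas.posSemidef.smul ?_
    exact_mod_cast (inv_pos.mpr hf0).le
  · rw [smul_mul_assoc, Matrix.trace_smul, smul_eq_mul, Complex.re_ofReal_mul,
      trace_mul_measMat_eq, quadForm_sub, abs_mul, abs_mul, abs_of_pos (inv_pos.mpr hf0),
      abs_of_pos hd0]
    have h1 := hfeas.nonSpiky g hg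
    have h2 := (isFeasible_lift hd hV C hε).nonSpiky g hg
    have h3 : |quadForm Γ g.1 - quadForm (lift V.1) g.1| ≤ β := by
      rw [abs_le]
      constructor <;> linarith
    have hβ : 0 ≤ β := h1.1.trans h1.2
    -- Both quadratic forms lie in `[0, β]`, so their difference is at most `β`; then `δ * d < f`
    -- turns `d * β / f` into `β / δ`.
    calc f⁻¹ * (d * |quadForm Γ g.1 - quadForm (lift V.1) g.1|) ≤ f⁻¹ * (d * β) := by gcongr
      _ ≤ β / δ := by
          rw [inv_mul_le_iff₀ hf0, mul_div_assoc', le_div_iff₀ hδ]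
          nlinarith

theorem frobNorm_le_of_lower_bound (hd : 1 ≤ d) (hm : 0 < m) {β δ r : ℝ} (hδ : 0 < δ) (hr : 1 ≤ r)
    (hν : ∀ Z, IsTestMatrix G (β / δ) Z → 1 ≤ β / δ) {C : Fin m → U d}
    (hC : ∀ Z, IsTestMatrix G (β / δ) Z → (m : ℝ) / 6 ≤ ∑ i, (Z * measMat (C i)).trace.re ^ 2)
    {V : U d} (hV : IsNonSpiky G β V) {η : ℝ} {ε : EuclideanSpace ℝ (Fin m)} (hε : ‖ε‖ ≤ η)
    {Γ : Matrix (Fin d × Fin d) (Fin d × Fin d) ℂ}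
    (hΓ : IsSolution G β C (measOp C (lift V.1) + ε) η Γ) :
    frobNorm (Γ - lift V.1) ≤ max (δ * frobNorm (lift V.1))
      (16 * η * (β / δ) ^ 2 / Real.sqrt m * r) := by
  rcases le_or_gt (frobNorm (Γ - lift V.1)) (δ * d) with h | h
  · rw [frobNorm_lift]
    exact h.trans (le_max_left _ _)
  refine le_trans ?_ (le_max_right _ _)
  have hZ := isTestMatrix_of_isSolution hd hδ hV hε hΓ h
  have hν1 := hν _ hZ
  have hlow := hC _ hZ
  set f := frobNorm (Γ - lift V.1) with hf
  have hf0 : 0 < f := lt_of_le_of_lt (by positivity) h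
  have hη : 0 ≤ η := (norm_nonneg _).trans hε
  have hm0 : (0 : ℝ) < m := by exact_mod_cast hm
  have hsq : 0 < Real.sqrt m := Real.sqrt_pos.mpr hm0
  have h1 : ∑ i, ((((f⁻¹ : ℝ) : ℂ) • (Γ - lift V.1)) * measMat (C i)).trace.re ^ 2 =
      (f⁻¹) ^ 2 * ‖measOp C (Γ - lift V.1)‖ ^ 2 := by
    rw [EuclideanSpace.norm_sq_eq, Finset.mul_sum]
    refine Finset.sum_congr rfl fun i _ => ?_
    rw [measOp_apply, smul_mul_assoc, Matrix.trace_smul, smul_eq_mul, Complex.re_ofReal_mul,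
      mul_pow, Real.norm_eq_abs, sq_abs]
  have h2 : ‖measOp C (Γ - lift V.1)‖ ≤ 2 * η := by
    have e : measOp C (Γ - lift V.1) = (measOp C Γ - (measOp C (lift V.1) + ε)) + ε := by
      rw [measOp_sub]; abel
    rw [e]
    refine (norm_add_le _ _).trans ?_
    linarith [hΓ.1.data]
  rw [h1, inv_pow, ← div_eq_inv_mul, le_div_iff₀ (by positivity)] at hlow
  have h3 : ‖measOp C (Γ - lift V.1)‖ ^ 2 ≤ (2 * η) ^ 2 := by gcongr
  -- The lower bound gives `m * f ^ 2 ≤ 24 * η ^ 2`, well within `256 * η ^ 2`. The further factors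
  -- `ν ^ 2` and `r` cost nothing, both being at least 1.
  have h4 : Real.sqrt m * f ≤ 16 * η := by
    refine le_of_sq_le_sq ?_ (by positivity)
    rw [mul_pow, Real.sq_sqrt hm0.le]
    nlinarith [sq_nonneg η]
  calc f ≤ 16 * η / Real.sqrt m := by
        rw [le_div_iff₀ hsq]
        linarith
    _ ≤ 16 * η * (β / δ) ^ 2 / Real.sqrt m := by
        refine div_le_div_of_nonneg_right ?_ hsq.le
        exact le_mul_of_one_le_right (by positivity) (by nlinarith)
    _ ≤ _ := le_mul_of_one_le_right (by positivity) hr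

/-- The left side is the mass of the atoms of `S` whose coordinates lie in `G`. Only monotonicity is
used, so `S` need not be measurable. -/
theorem prodMean_indicator_le_pi {D : Measure (U d)} [IsProbabilityMeasure D]
    (S : Set (Fin m → U d)) :
    prodMean (weight D G) (Set.indicator {C : Fin m → G | (fun i => (C i).1) ∈ S} 1) ≤
      (Measure.pi fun _ : Fin m => D).real S := by
  classical
  set φ : (Fin m → G) → Fin m → U d := fun C i => (C i).1 with hφ
  have hinj : Function.Injective φ := fun C C' h => funext fun i => Subtype.ext (congrFun h i)
  set F : Finset (Fin m → G) := {C | φ C ∈ S} with hF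
  have h1 : prodMean (weight D G) (Set.indicator {C : Fin m → G | φ C ∈ S} 1) =
      ∑ C ∈ F, ∏ i, weight D G (C i) := by
    rw [prodMean, hF, Finset.sum_filter]
    refine Finset.sum_congr rfl fun C _ => ?_
    simp [Set.indicator_apply]
  have h2 : ∑ C ∈ F, ∏ i, weight D G (C i) =
      (Measure.pi fun _ : Fin m => D).real (F.image φ : Finset (Fin m → U d)) := by
    rw [← sum_measureReal_singleton, Finset.sum_image fun _ _ _ _ h => hinj h]
    refine Finset.sum_congr rfl fun C _ => ?_
    rw [measureReal_def, Measure.pi_singleton, ENNReal.toReal_prod]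
    rfl
  rw [h1, h2]
  refine measureReal_mono ?_
  intro C hC
  obtain ⟨C', hC', rfl⟩ := Finset.mem_image.mp (Finset.mem_coe.mp hC)
  exact (Finset.mem_filter.mp hC').2

theorem prodMean_exists_testMatrix_le_exp {D : Measure (U d)} [IsProbabilityMeasure D]
    (hG : D ((G : Set (U d))ᶜ) = 0) (hD : IsUnitaryDesign 2 D) (hd : 1 ≤ d) {ν c₀ : ℝ}
    (hc₀ : 400 ≤ c₀) (hm0 : 0 < m)
    (hm : (8 * c₀ * ν ^ 2) ^ 2 * ((d : ℝ) ^ 2 * Real.log d) ≤ (m : ℝ)) :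
    prodMean (weight D G) (Set.indicator {C : Fin m → G | ∃ t : {Z // IsTestMatrix G ν Z},
      ∑ i, (t.1 * measMat (C i).1).trace.re ^ 2 < m / 6} 1) ≤
      Real.exp (-(1 / 128) * m * (ν ^ 4)⁻¹) := by
  have hempty : (∀ C : Fin m → G, ¬∃ t : {Z // IsTestMatrix G ν Z},
      ∑ i, (t.1 * measMat (C i).1).trace.re ^ 2 < m / 6) →
      prodMean (weight D G) (Set.indicator {C : Fin m → G | ∃ t : {Z // IsTestMatrix G ν Z},
        ∑ i, (t.1 * measMat (C i).1).trace.re ^ 2 < m / 6} 1) ≤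
        Real.exp (-(1 / 128) * m * (ν ^ 4)⁻¹) := by
    intro h
    have h' : {C : Fin m → G | ∃ t : {Z // IsTestMatrix G ν Z},
        ∑ i, (t.1 * measMat (C i).1).trace.re ^ 2 < m / 6} = ∅ :=
      Set.eq_empty_of_forall_notMem fun C hC => h C hC
    rw [h', Set.indicator_empty, prodMean_const (isWeight_weight hG)]
    positivity
  rcases isEmpty_or_nonempty {Z // IsTestMatrix G ν Z} with hT | hT
  · exact hempty fun C ⟨t, _⟩ => hT.elim t
  -- In dimension one `log d = 0` and the sample size condition says nothing, but the squared
  -- measurements of a test matrix then sum to exactly `m`.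
  rcases hd.eq_or_lt with rfl | hd2
  · refine hempty fun C ⟨t, ht⟩ => ?_
    simp only [trace_mul_measMat_sq_of_dim_one t.2.isHermitian, t.2.frobNorm_eq, Finset.sum_const,
      Finset.card_univ, Fintype.card_fin, nsmul_eq_mul] at ht
    have : (0 : ℝ) < m := by exact_mod_cast hm0
    linarith
  · refine (prodMean_exists_testMatrix_le hG hD hd2 hc₀ hm).trans (Real.exp_le_exp.mpr ?_)
    have h : 0 ≤ (m : ℝ) * (ν ^ 4)⁻¹ := by positivity
    have e : (m : ℝ) / (8 * ν ^ 4) = m * (ν ^ 4)⁻¹ / 8 := by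
      rw [mul_comm, ← div_div, div_eq_mul_inv (m : ℝ)]
    rw [e]
    linarith

theorem one_le_of_isTestMatrix {D : Measure (U d)} [IsProbabilityMeasure D]
    (hG : D ((G : Set (U d))ᶜ) = 0) (hD : IsUnitaryDesign 2 D) (hd : 1 ≤ d) {ν : ℝ}
    {Z : Matrix (Fin d × Fin d) (Fin d × Fin d) ℂ} (hZ : IsTestMatrix G ν Z) : 1 ≤ ν := by
  refine hZ.one_le (isWeight_weight hG) ?_
  rcases hd.eq_or_lt with rfl | hd2
  · simp only [trace_mul_measMat_sq_of_dim_one hZ.isHermitian, hZ.frobNorm_eq, one_pow, mul_one]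
    exact (isWeight_weight hG).sum_eq.ge
  · have := frobNorm_sq_le_sum_weight_mul hG hD hd2 hZ.isHermitian hZ.ptrace₁_eq hZ.ptrace₂_eq
    rwa [hZ.frobNorm_eq, one_pow] at this

end Program

end PhaseLift

/-! ### Conclusion: choice of the constant and transfer to the product measure. -/

theorem theorem2 :
    ∃ c₅ : ℝ, 0 < c₅ ∧
      ∀ (δ c₀ : ℝ), 0 < δ → 2 * c₅ < c₀ →
      ∀ (d : ℕ), 1 ≤ d →
      ∀ (G : Finset (PhaseLift.U d)) (D : Measure (PhaseLift.U d)),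
        IsProbabilityMeasure D → D ((G : Set (PhaseLift.U d))ᶜ) = 0 →
        PhaseLift.IsUnitaryDesign 2 D →
      ∀ (β ν : ℝ), 0 ≤ β → ν = β / δ →
      ∀ m : ℕ, (8 * c₀ * ν ^ 2) ^ 2 * ((d : ℝ) ^ 2 * Real.log d) ≤ (m : ℝ) →
        1 - Real.exp (-(1 / 128) * (m : ℝ) * (ν ^ 4)⁻¹) ≤
          (Measure.pi fun _ : Fin m => D).real
            {C : Fin m → PhaseLift.U d |
              ∀ V : PhaseLift.U d, PhaseLift.IsNonSpiky G β V →
              ∀ (η : ℝ) (ε : EuclideanSpace ℝ (Fin m)), ‖ε‖ ≤ η →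
              ∀ Γ : Matrix (Fin d × Fin d) (Fin d × Fin d) ℂ,
                PhaseLift.IsSolution G β C
                  (PhaseLift.measOp C (PhaseLift.lift V.1) + ε) η Γ →
                PhaseLift.frobNorm (Γ - PhaseLift.lift V.1) ≤
                  max (δ * PhaseLift.frobNorm (PhaseLift.lift V.1))
                    (16 * η * ν ^ 2 / Real.sqrt m * (1 + 2 * c₅ / (c₀ - 2 * c₅)))} := by
  -- Half of the 400 that the complexity estimate requires of `c₀`.
  refine ⟨200, by norm_num, ?_⟩
  intro δ c₀ hδ hc₀ d hd G D hDprob hG hD β ν _ hν m hm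
  have hc₀' : 400 ≤ c₀ := by linarith
  rcases Nat.eq_zero_or_pos m with rfl | hm0
  -- With no samples the claimed probability is `1 - exp 0 = 0`.
  · simp
  refine le_trans ?_ (PhaseLift.prodMean_indicator_le_pi (G := G) (D := D) _)
  have hbad := PhaseLift.prodMean_exists_testMatrix_le_exp (ν := ν) hG hD hd hc₀' hm0 hm
  have hw := PhaseLift.isWeight_weight hG
  set bad := {C : Fin m → G | ∃ t : {Z // PhaseLift.IsTestMatrix G ν Z},
    ∑ i, (t.1 * PhaseLift.measMat (C i).1).trace.re ^ 2 < m / 6} with hbadd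
  calc 1 - Real.exp (-(1 / 128) * (m : ℝ) * (ν ^ 4)⁻¹) ≤
        1 - PhaseLift.prodMean (PhaseLift.weight D G) (bad.indicator 1) :=
        sub_le_sub_left hbad 1
    _ = PhaseLift.prodMean (PhaseLift.weight D G) fun C => 1 - bad.indicator 1 C := by
        rw [PhaseLift.prodMean_sub, PhaseLift.prodMean_const hw]
    _ ≤ _ := ?_
  refine PhaseLift.prodMean_mono hw fun C => ?_
  by_cases hC : C ∈ bad
  · rw [Set.indicator_of_mem hC, Pi.one_apply, sub_self]
    exact Set.indicator_nonneg (fun _ _ => zero_le_one) _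
  rw [Set.indicator_of_notMem hC, sub_zero, Set.indicator_of_mem]
  · rfl
  have hC' : ¬∃ t : {Z // PhaseLift.IsTestMatrix G ν Z},
    ∑ i, (t.1 * PhaseLift.measMat (C i).1).trace.re ^ 2 < m / 6 := hC
  push Not at hC'
  intro V hV η ε hε Γ hΓ
  rw [hν]
  refine PhaseLift.frobNorm_le_of_lower_bound hd hm0 hδ ?_
    (fun Z hZ => PhaseLift.one_le_of_isTestMatrix hG hD hd hZ)
    (fun Z hZ => hC' ⟨Z, hν ▸ hZ⟩) hV hε hΓ
  have : 0 ≤ 2 * 200 / (c₀ - 2 * 200) := div_nonneg (by norm_num) (by linarith)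
  linarith
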